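/- Setting. Let $\mathbb{X}$ be either $\mathbb{R}^{n\times m}$ ($n\le m$) or the space $\mathbb{S}^n$ of real symmetric $n\times n$ matrices, with the trace inner product, and let $\mathbb{Z}:=\mathbb{R}^e\times\mathbb{R}^d\times\mathbb{X}$, with elements $Z=(y,w,S)$. Let $C\in\mathbb{X}$ and $b\in\mathbb{R}^e$, let $\mathcal{F}:\mathbb{X}\to\mathbb{R}^d$ and $\mathcal{A}:\mathbb{X}\to\mathbb{R}^e$ be linear, let $h:\mathbb{R}^d\to(-\infty,+\infty]$ be convex and continuously differentiable on $\operatorname{dom}h$, which is a nonempty open convex set, and let $\mathcal{Q}\subseteq\mathbb{R}^e$ be a convex polyhedral cone with dual cone $\mathcal{Q}^*=\{y\mid\langle y,q\rangle\ge 0\ \forall q\in\mathcal{Q}\}$. Let $\theta:\mathbb{X}\to(-\infty,+\infty]$ be a spectral function, that is, either (i) $\theta(X)=g(\sigma(X))$ with $g:\mathbb{R}^n\to(-\infty,+\infty]$ proper closed convex and absolutely symmetric (invariant under permutations and sign changes of the coordinates), where $\sigma(X)\in\mathbb{R}^n$ is the vector of singular values of $X$ in non-increasing order; or (ii) $\mathbb{X}=\mathbb{S}^n$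 and $\theta(X)=g(\lambda(X))$ with $g:\mathbb{R}^n\to(-\infty,+\infty]$ proper closed convex and symmetric (invariant under permutations of the coordinates), where $\lambda(X)\in\mathbb{R}^n$ is the vector of eigenvalues of $X$ in non-increasing order. The primal problem is to minimize $h(\mathcal{F}X)+\langle C,X\rangle+\theta(X)$ over $X\in\mathbb{X}$ with $\mathcal{A}X\in b+\mathcal{Q}$. Its dual is $$\min_{Z=(y,w,S)\in\mathbb{Z}}\ \Psi(Z):=\delta_{\mathcal{Q}^*}(y)-\langle b,y\rangle+h^*(-w)+\theta^*(-S)\quad\text{s.t.}\quad \mathcal{A}^*y+\mathcal{F}^*w+S=C, \qquad (2)$$ where $h^*,\theta^*$ are the conjugate functions and $\delta_{\mathcal{Q}^*}$ is the indicator function. Let $F_D$ be the set of all $Z\in\mathbb{Z}$ with $\mathcal{A}^*y+\mathcal{F}^*w+S=C$ and $y\in\mathcal{Q}^*$, and let $\Omega_D$ be the set of optimal solutions of (2). For $\overline Z=(\bar y,\bar w,\overline S)\in\Omega_D$ let $\mathcal{M}_D(\overline Z)$ be the set of all $X\in\mathbb{X}$ with $$b-\mathcal{A}X\in\mathcal{N}_{\mathcal{Q}^*}(\bar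 y),\quad \mathcal{F}X\in\partial h^*(-\bar w),\quad X\in\partial\theta^*(-\overline S),\quad \mathcal{A}^*\bar y+\mathcal{F}^*\bar w+\overline S=C,$$ where $\mathcal{N}$ is the normal cone and $\partial$ the subdifferential of convex analysis. For $X\in\mathbb{X}$ put $$\mathcal{V}_D:=\{Z\mid \mathcal{A}^*y+\mathcal{F}^*w+S=C\},\qquad \mathcal{G}_D^1(X):=\{Z\mid b-\mathcal{A}X\in\mathcal{N}_{\mathcal{Q}^*}(y)\},$$ $$\mathcal{G}_D^2(X):=\{Z\mid w=\bar w\},\qquad \mathcal{G}_D^3(X):=\{Z\mid -S\in\partial\theta(X)\}.$$ A set-valued mapping $G$ between Euclidean spaces is metrically subregular at $\bar u$ for $\bar v$ if $\bar v\in G(\bar u)$ and there are $\delta,\varepsilon,\kappa>0$ with $\operatorname{dist}(u,G^{-1}(\bar v))\le\kappa\operatorname{dist}(\bar v,G(u)\cap\mathbb{B}_\delta(\bar v))$ for all $u\in\mathbb{B}_\varepsilon(\bar u)$, where $\mathbb{B}_\rho(x)$ is the closed ball of radius $\rho$ around $x$ and the distance to $\emptyset$ is $+\infty$. A finite collection of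 closed convex sets $D_1,\dots,D_s$ with nonempty intersection $D$ is boundedly linearly regular if for every bounded set $\mathcal{B}$ there is $\kappa>0$ with $\operatorname{dist}(x,D)\le\kappa\max_i\operatorname{dist}(x,D_i)$ for all $x\in\mathcal{B}$. Theorem. Let $\overline Z=(\bar y,\bar w,\overline S)$ be an optimal solution of (2) with $\mathcal{M}_D(\overline Z)\ne\emptyset$. Assume that (a) $h^*$ is continuously differentiable on $\operatorname{dom}h^*$, which is a nonempty open convex set, and $h^*$ is strongly convex on every (convex) compact subset of $\operatorname{dom}h^*$; (b) for every $\bar v\in\partial g^*(\sigma(\overline S))$ in case (i), respectively every $\bar v\in\partial g^*(\lambda(-\overline S))$ in case (ii), the mapping $\partial g^*$ is metrically subregular at $\sigma(\overline S)$, respectively at $\lambda(-\overline S)$, for $\bar v$; (c) the collection $\{\mathcal{V}_D,\mathcal{G}_D^1(\overline X),\mathcal{G}_D^2(\overline X),\mathcal{G}_D^3(\overline X)\}$ is boundedly linearly regular for some $\overline X\in\mathcal{M}_D(\overline Z)$. Then the quadratic growth condition holds at $\overline Z$ for (2): there are $\delta_d>0$ and $\kappa_d>0$ such that $$\Psi(Z)\ge\Psi(\overline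 Z)+\kappa_d\operatorname{dist}^2(Z,\Omega_D)\qquad\forall\,Z\in F_D\cap\mathbb{B}_{\delta_d}(\overline Z).$$ -/

import Mathlib

open scoped InnerProductSpace

namespace MatrixOpt

section ConvexAnalysis

variable {U V : Type*} [NormedAddCommGroup U] [InnerProductSpace ℝ U]
  [NormedAddCommGroup V] [InnerProductSpace ℝ V]

/-- The effective domain of an extended-valued function. -/
def effDom (p : U → EReal) : Set U := {x | p x < ⊤}

/-- A function with values in `(-∞, +∞]` that is not identically `+∞`. -/
def IsProper (p : U → EReal) : Prop := (∀ x, p x ≠ ⊥) ∧ (effDom p).Nonempty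

/-- Convexity of an extended-valued function: its epigraph is convex. -/
def IsConvexFun (p : U → EReal) : Prop :=
  Convex ℝ {z : U × ℝ | p z.1 ≤ (z.2 : EReal)}

/-- Proper closed (that is, lower semicontinuous) convex functions. -/
structure IsProperClosedConvex (p : U → EReal) : Prop where
  proper : IsProper p
  closed : LowerSemicontinuous p
  convex : IsConvexFun p

/-- The (Fenchel) conjugate function. -/
noncomputable def conj (p : U → EReal) (v : U) : EReal :=
  ⨆ x : U, ((⟪v, x⟫_ℝ : ℝ) : EReal) - p x

/-- The subdifferential of convex analysis. For a proper function it is empty off the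
effective domain. -/
def subdiff (p : U → EReal) (x : U) : Set U :=
  {v | ∀ x', p x + ((⟪v, x' - x⟫_ℝ : ℝ) : EReal) ≤ p x'}

/-- The normal cone of convex analysis, empty at points outside the set. -/
def normalCone (D : Set U) (u : U) : Set U :=
  {v | u ∈ D ∧ ∀ u' ∈ D, ⟪v, u' - u⟫_ℝ ≤ 0}

/-- The indicator function, `0` on the set and `+∞` outside. -/
noncomputable def indicatorFun (D : Set U) (u : U) : EReal :=
  open scoped Classical in if u ∈ D then 0 else ⊤

/-- `p` is continuously differentiable on its effective domain, which is a nonempty open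
convex set. -/
structure IsC1OnOpenDomain (p : U → EReal) : Prop where
  nonempty : (effDom p).Nonempty
  isOpen : IsOpen (effDom p)
  convex : Convex ℝ (effDom p)
  contDiffOn : ContDiffOn ℝ 1 (fun x => (p x).toReal) (effDom p)

/-- `p` is strongly convex on every (convex) compact subset of its effective domain; the modulus
may depend on the subset. -/
def IsStronglyConvexOnCompacts (p : U → EReal) : Prop :=
  ∀ K ⊆ effDom p, IsCompact K → Convex ℝ K →
    ∃ μ : ℝ, 0 < μ ∧ StrongConvexOn K μ (fun x => (p x).toReal)

/-- Metric subregularity of a set-valued mapping `G` at `u` for `v`. Distances are extended,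
so that the distance to the empty set is `+∞`. -/
def MetricallySubregularAt (G : U → Set V) (u : U) (v : V) : Prop :=
  v ∈ G u ∧ ∃ δ > (0 : ℝ), ∃ ε > (0 : ℝ), ∃ κ > (0 : ℝ), ∀ x ∈ Metric.closedBall u ε,
    Metric.infEDist x {x' | v ∈ G x'} ≤
      ENNReal.ofReal κ * Metric.infEDist v (G x ∩ Metric.closedBall v δ)

/-- Bounded linear regularity of a finite collection of (closed convex) sets. -/
def BoundedlyLinearlyRegular {s : ℕ} (D : Fin s → Set U) : Prop :=
  (⋂ i, D i).Nonempty ∧ ∀ B : Set U, Bornology.IsBounded B → ∃ κ > (0 : ℝ), ∀ x ∈ B,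
    Metric.infDist x (⋂ i, D i) ≤ κ * ⨆ i, Metric.infDist x (D i)

/-- Convex polyhedral cones: finite intersections of closed homogeneous half-spaces. -/
def IsPolyhedralCone (Q : Set U) : Prop :=
  ∃ (k : ℕ) (a : Fin k → U), Q = {q | ∀ i, 0 ≤ ⟪a i, q⟫_ℝ}

end ConvexAnalysis

section Matrices

/-- The Euclidean space `ℝ^{n × m}` of real matrices with the trace (Frobenius) inner product:
the entry in row `i`, column `j` is `X (i, j)`. -/
abbrev RectMat (n m : ℕ) : Type := EuclideanSpace ℝ (Fin n × Fin m)

/-- The linear map `ℝ^m → ℝ^n` given by a matrix. -/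
noncomputable def RectMat.toLin {n m : ℕ} (X : RectMat n m) :
    EuclideanSpace ℝ (Fin m) →ₗ[ℝ] EuclideanSpace ℝ (Fin n) :=
  Matrix.toEuclideanLin (Matrix.of fun i j => X (i, j))

/-- The vector of the `n` largest singular values of an `n × m` matrix (all of them if `n ≤ m`),
in non-increasing order. -/
noncomputable def RectMat.sigma {n m : ℕ} (X : RectMat n m) : EuclideanSpace ℝ (Fin n) :=
  WithLp.toLp 2 fun i => X.toLin.singularValues i

/-- The subspace of symmetric `n × n` matrices. -/
def symSubmodule (n : ℕ) : Submodule ℝ (RectMat n n) where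
  carrier := {X | ∀ i j, X (i, j) = X (j, i)}
  add_mem' := fun {X Y} hX hY i j => by
    rw [PiLp.add_apply, PiLp.add_apply, hX i j, hY i j]
  zero_mem' := fun _ _ => rfl
  smul_mem' := fun c X hX i j => by
    rw [PiLp.smul_apply, PiLp.smul_apply, hX i j]

/-- The Euclidean space `𝕊^n` of real symmetric matrices with the trace inner product. -/
abbrev SymMat (n : ℕ) : Type := symSubmodule n

theorem SymMat.isSymmetric_toLin {n : ℕ} (X : SymMat n) : (X : RectMat n n).toLin.IsSymmetric := by
  refine Matrix.isSymmetric_toEuclideanLin_iff.2 ?_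
  ext i j
  simpa using X.2 j i

/-- The vector of singular values of a symmetric matrix, in non-increasing order. -/
noncomputable def SymMat.sigma {n : ℕ} (X : SymMat n) : EuclideanSpace ℝ (Fin n) :=
  RectMat.sigma (X : RectMat n n)

/-- The vector of eigenvalues of a symmetric matrix, in non-increasing order. -/
noncomputable def SymMat.lam {n : ℕ} (X : SymMat n) : EuclideanSpace ℝ (Fin n) :=
  WithLp.toLp 2 fun i => X.isSymmetric_toLin.eigenvalues finrank_euclideanSpace_fin i

/-- Invariance under permutations of the coordinates. -/
def IsSymmetricFun {n : ℕ} (g : EuclideanSpace ℝ (Fin n) → EReal) : Prop :=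
  ∀ (π : Equiv.Perm (Fin n)) (x : EuclideanSpace ℝ (Fin n)),
    g (WithLp.toLp 2 fun i => x (π i)) = g x

/-- Invariance under permutations and sign changes of the coordinates. -/
def IsAbsSymmetricFun {n : ℕ} (g : EuclideanSpace ℝ (Fin n) → EReal) : Prop :=
  ∀ (π : Equiv.Perm (Fin n)) (s : Fin n → ℝ), (∀ i, s i = 1 ∨ s i = -1) →
    ∀ x : EuclideanSpace ℝ (Fin n), g (WithLp.toLp 2 fun i => s i * x (π i)) = g x

end Matrices

section Problems

/-- The data of the problem: minimize `h (F X) + ⟪C, X⟫ + θ X` over `X` in the Euclidean space `E`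
subject to `A X ∈ b + Q`. -/
structure Problem (E : Type) [NormedAddCommGroup E] [InnerProductSpace ℝ E] (d e : ℕ) where
  h : EuclideanSpace ℝ (Fin d) → EReal
  θ : E → EReal
  C : E
  F : E →ₗ[ℝ] EuclideanSpace ℝ (Fin d)
  A : E →ₗ[ℝ] EuclideanSpace ℝ (Fin e)
  b : EuclideanSpace ℝ (Fin e)
  Q : Set (EuclideanSpace ℝ (Fin e))

/-- The Euclidean space of the dual variables `(y, w, S) ∈ ℝ^e × ℝ^d × E`. -/
abbrev DualVar (E : Type) [NormedAddCommGroup E] [InnerProductSpace ℝ E] (d e : ℕ) : Type :=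
  WithLp 2 (EuclideanSpace ℝ (Fin e) × WithLp 2 (EuclideanSpace ℝ (Fin d) × E))

variable {E : Type} [NormedAddCommGroup E] [InnerProductSpace ℝ E] {d e : ℕ}

/-- The component `y` of `(y, w, S)`. -/
def DualVar.y (Z : DualVar E d e) : EuclideanSpace ℝ (Fin e) := Z.fst

/-- The component `w` of `(y, w, S)`. -/
def DualVar.w (Z : DualVar E d e) : EuclideanSpace ℝ (Fin d) := Z.snd.fst

/-- The component `S` of `(y, w, S)`. -/
def DualVar.S (Z : DualVar E d e) : E := Z.snd.snd

/-- The set of `(y, w, S)` with `w` equal to the given vector. -/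
def GD2 (wbar : EuclideanSpace ℝ (Fin d)) : Set (DualVar E d e) :=
  {Z | DualVar.w Z = wbar}

namespace Problem

variable (P : Problem E d e)

/-- The assumptions on `h` and `Q` that are part of the problem formulation: `h` is a convex
function with values in `(-∞, +∞]`, continuously differentiable on its effective domain, which is
nonempty, open and convex, and `Q` is a convex polyhedral cone. -/
structure IsAdmissible : Prop where
  h_proper : IsProper P.h
  h_convex : IsConvexFun P.h
  h_c1 : IsC1OnOpenDomain P.h
  polyhedral : IsPolyhedralCone P.Q

/-- The dual cone `Q*` of `Q`. -/
def dualCone : Set (EuclideanSpace ℝ (Fin e)) := {y | ∀ q ∈ P.Q, 0 ≤ ⟪y, q⟫_ℝ}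

/-- The dual objective function
`Ψ (y, w, S) = δ_{Q*} (y) - ⟪b, y⟫ + h* (-w) + θ* (-S)`. -/
noncomputable def dualObj (Z : DualVar E d e) : EReal :=
  indicatorFun P.dualCone (DualVar.y Z) - ((⟪P.b, DualVar.y Z⟫_ℝ : ℝ) : EReal)
    + conj P.h (-DualVar.w Z) + conj P.θ (-DualVar.S Z)

/-- The set of `(y, w, S)` with `0 ∈ A X - b + N_{Q*} (y)`. -/
def GD1 (X : E) : Set (DualVar E d e) :=
  {Z | P.b - P.A X ∈ normalCone P.dualCone (DualVar.y Z)}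

/-- The set of `(y, w, S)` with `0 ∈ S + ∂θ (X)`. -/
def GD3 (X : E) : Set (DualVar E d e) :=
  {Z | -DualVar.S Z ∈ subdiff P.θ X}

variable [FiniteDimensional ℝ E]

/-- The affine space `A* y + F* w + S = C`. -/
noncomputable def VD : Set (DualVar E d e) :=
  {Z | LinearMap.adjoint P.A (DualVar.y Z) + LinearMap.adjoint P.F (DualVar.w Z)
    + DualVar.S Z = P.C}

/-- The set of feasible points of the dual problem. -/
noncomputable def dualFeasible : Set (DualVar E d e) := {Z | Z ∈ P.VD ∧ DualVar.y Z ∈ P.dualCone}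

/-- The set of optimal solutions of the dual problem: minimize `Ψ (y, w, S)` subject to
`A* y + F* w + S = C`. -/
noncomputable def dualSolutions : Set (DualVar E d e) :=
  {Z | Z ∈ P.dualFeasible ∧ P.dualObj Z < ⊤ ∧ ∀ Z' ∈ P.dualFeasible, P.dualObj Z ≤ P.dualObj Z'}

/-- The set of Lagrange multipliers at `Z = (y, w, S)` for the dual problem, defined by the
KKT system. -/
noncomputable def dualMultipliers (Z : DualVar E d e) : Set E :=
  {X | P.b - P.A X ∈ normalCone P.dualCone (DualVar.y Z) ∧
    P.F X ∈ subdiff (conj P.h) (-DualVar.w Z) ∧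
    X ∈ subdiff (conj P.θ) (-DualVar.S Z) ∧
    LinearMap.adjoint P.A (DualVar.y Z) + LinearMap.adjoint P.F (DualVar.w Z)
      + DualVar.S Z = P.C}

/-- The quadratic growth condition at `Zbar` for the dual problem. -/
def DualQuadraticGrowthAt (Zbar : DualVar E d e) : Prop :=
  ∃ δ > (0 : ℝ), ∃ κ > (0 : ℝ), ∀ Z ∈ P.dualFeasible ∩ Metric.closedBall Zbar δ,
    P.dualObj Zbar + ((κ * Metric.infDist Z P.dualSolutions ^ 2 : ℝ) : EReal) ≤ P.dualObj Z

end Problem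

end Problems

end MatrixOpt

/-! A multiplier `X` supplies a subgradient at `Zbar` for each of the three nonlinear terms of the
dual objective. On the affine space `VD` the three linearisations add up to `⟪b, y⟫` plus a constant
(`inner_multiplier_eq`), which cancels the term `-⟪b, y⟫`. Hence `Ψ Z - Ψ Zbar` is bounded below by
the sum of the three excesses over the linearisations. The indicator of the polyhedral cone `Q*`
grows linearly away from a face (Farkas), `h*` grows quadratically away from `-w̄` by strong
convexity, and `θ*` grows quadratically away from `∂θ(X)`. So the objective grows quadratically away
from each of the four sets (`dualObj_growth`). Bounded linear regularity turns this into growth away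
from their intersection, which consists of optimal solutions (`mem_dualSolutions_of_mem_inter`).

The growth of `θ*` is the hard part. For a convex function a local error bound `dist(x, A) ≤ κ ‖w -
v‖`, `w ∈ ∂f(x)`, forces quadratic growth, by a proximal argument
(`quadratic_growth_of_subdiff_error_bound`). The error bound for `θ*` is inherited from `g*`: if `X'
∈ ∂θ*(T')`, then `X'` and `T'` have a common frame `φ`, and subregularity gives `u` near `γ T'` with
`γ X ∈ ∂g*(u)`. The point `φ u` would lie in `∂θ(X)` if `φ` diagonalised `X`; it nearly does, and it
can be replaced by an exact frame at distance `O(‖X' - X‖)`.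

This stability of frames rests on `exists_near_commuting`: an orthogonal matrix that almost commutes
with `J` is linearly close to one that commutes with it. A block matrix carries the rectangular
case. Eigenvalues and singular values are treated together through `IsSpectralMap`; singular values
on `𝕊^n` reduce to eigenvalues by sign invariance of `g`. -/

namespace MatrixOpt

/-! ### Conjugates, and quadratic growth from a subdifferential error bound. -/

section Growth

variable {U : Type*} [NormedAddCommGroup U] [InnerProductSpace ℝ U]

theorem le_coe_iff_of_conj {p : U → EReal} {v : U} {a : ℝ} :
    conj p v ≤ a ↔ ∀ x, ((⟪v, x⟫_ℝ : ℝ) : EReal) - p x ≤ a := by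
  simp [conj]

theorem sub_le_coe_iff (r a : ℝ) (p : EReal) :
    ((r : ℝ) : EReal) - p ≤ a ↔ ((r - a : ℝ) : EReal) ≤ p := by
  induction p with
  | bot =>
    rw [EReal.coe_sub_bot]
    exact iff_of_false (not_le.2 (EReal.coe_lt_top _)) (not_le.2 (EReal.bot_lt_coe _))
  | top => simp
  | coe b => norm_cast; constructor <;> intro h <;> linarith

theorem conj_le_coe_iff {p : U → EReal} {v : U} {a : ℝ} :
    conj p v ≤ a ↔ ∀ x, ((⟪v, x⟫_ℝ - a : ℝ) : EReal) ≤ p x := by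
  simp [le_coe_iff_of_conj, sub_le_coe_iff]

theorem isConvexFun_conj (p : U → EReal) : IsConvexFun (conj p) := by
  rintro ⟨v, a⟩ hv ⟨w, b⟩ hw s t hs ht hst
  simp only [Set.mem_ofPred_eq, Prod.smul_mk, Prod.mk_add_mk, conj_le_coe_iff] at *
  intro x
  have h1 := hv x
  have h2 := hw x
  induction hp : p x with
  | bot => rw [hp] at h1; exact absurd h1 (not_le.2 (EReal.bot_lt_coe _))
  | top => simp
  | coe c =>
    rw [hp] at h1 h2
    norm_cast at *
    rw [inner_add_left, real_inner_smul_left, real_inner_smul_left]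
    simp only [smul_eq_mul]
    have : c = s * c + t * c := by rw [← add_mul, hst, one_mul]
    rw [this]
    nlinarith [mul_le_mul_of_nonneg_left h1 hs, mul_le_mul_of_nonneg_left h2 ht]

theorem lowerSemicontinuous_conj (p : U → EReal) : LowerSemicontinuous (conj p) := by
  unfold conj
  refine lowerSemicontinuous_iSup fun x => ?_
  have : Continuous fun v : U => ((⟪v, x⟫_ℝ : ℝ) : EReal) - p x := by
    induction p x with
    | bot => simpa using continuous_const
    | top => simpa using continuous_const
    | coe c =>
      have : Continuous fun v : U => ((⟪v, x⟫_ℝ - c : ℝ) : EReal) :=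
        continuous_coe_real_ereal.comp (by fun_prop)
      simpa using this
  exact this.lowerSemicontinuous

theorem IsConvexFun.combo_le {f : U → EReal} (hf : IsConvexFun f) {x y : U} {a b t : ℝ}
    (hx : f x ≤ a) (hy : f y ≤ b) (h0 : 0 ≤ t) (h1 : t ≤ 1) :
    f (x + t • (y - x)) ≤ ((1 - t) * a + t * b : ℝ) := by
  have := hf (x := (x, a)) hx (y := (y, b)) hy (sub_nonneg.2 h1) h0 (by ring)
  simp only [Set.mem_ofPred_eq, Prod.smul_mk, Prod.mk_add_mk, smul_eq_mul] at this
  convert this using 2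
  module

theorem toReal_of_mem_subdiff {f : U → EReal} {v x : U} (hv : v ∈ subdiff f x)
    (hbot : ∀ y, f y ≠ ⊥) (hx : f x ≠ ⊤) (y : U) :
    ((f x).toReal + ⟪v, y - x⟫_ℝ : ℝ) ≤ f y := by
  have := hv y
  rwa [← EReal.coe_toReal hx (hbot x), ← EReal.coe_add] at this

/-- A convex function grows quadratically away from `A` if its subdifferential satisfies a local
error bound with respect to `A`. -/
theorem quadratic_growth_of_subdiff_error_bound [FiniteDimensional ℝ U] {f : U → EReal}
    (hbot : ∀ x, f x ≠ ⊥) (hlsc : LowerSemicontinuous f) (hconv : IsConvexFun f)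
    {x₀ v : U} (hv : v ∈ subdiff f x₀) (hx₀ : f x₀ ≠ ⊤) {A : Set U} (hA : x₀ ∈ A)
    (hsub : ∃ δ > (0 : ℝ), ∃ ε > (0 : ℝ), ∃ κ > (0 : ℝ), ∀ x ∈ Metric.closedBall x₀ ε,
      f x ≠ ⊤ → ∀ w ∈ subdiff f x, ‖w - v‖ ≤ δ → Metric.infDist x A ≤ κ * ‖w - v‖) :
    ∃ ε > (0 : ℝ), ∃ c > (0 : ℝ), ∀ x ∈ Metric.closedBall x₀ ε,
      (((f x₀).toReal + ⟪v, x - x₀⟫_ℝ + c * Metric.infDist x A ^ 2 : ℝ) : EReal) ≤ f x := by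
  obtain ⟨δ, hδ, ε, hε, κ, hκ, H⟩ := hsub
  -- The minimiser `y` below lies within `d / 2 ≤ ε / 4` of `x`, so `ε / 2` keeps it in the
  -- `ε`-ball; `δ * κ` keeps `‖w - v‖ = ‖y - x‖ / κ` below `δ`.
  refine ⟨min (ε / 2) (δ * κ), by positivity, 1 / (8 * κ), by positivity, fun x hx => ?_⟩
  rw [Metric.mem_closedBall, dist_eq_norm, le_min_iff] at hx
  obtain ⟨hx1, hx2⟩ := hx
  have hsg := toReal_of_mem_subdiff hv hbot hx₀
  set d := Metric.infDist x A with hd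
  have hd0 : 0 ≤ d := Metric.infDist_nonneg
  have hdx : d ≤ ‖x - x₀‖ := by
    rw [← dist_eq_norm]; exact Metric.infDist_le_dist_of_mem hA
  by_contra hlt
  rw [not_le] at hlt
  have hdpos : 0 < d := by
    rcases hd0.eq_or_lt with h | h
    · rw [← h] at hlt
      exact absurd (hsg x) (not_le.2 (by simpa using hlt))
    · exact h
  have hfx : f x ≠ ⊤ := ne_top_of_lt hlt
  -- Proximal step: `f`, tilted by `v` and penalised with weight `1 / (2κ)`, is minimised over the
  -- ball of radius `d` about `x`. Stationarity at the minimiser `y` reads `v + (x - y) / κ ∈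
  -- ∂f(y)`.
  obtain ⟨q, hq⟩ : ∃ q : U → ℝ, q = fun y => 1 / (2 * κ) * ‖y - x‖ ^ 2 - ⟪v, y - x⟫_ℝ := ⟨_, rfl⟩
  have hqc : Continuous q := by rw [hq]; fun_prop
  have hplsc : LowerSemicontinuous fun y => f y + (q y : EReal) := by
    refine LowerSemicontinuous.add' hlsc
      (continuous_coe_real_ereal.comp hqc).lowerSemicontinuous fun y => ?_
    exact EReal.continuousAt_add (Or.inr (EReal.coe_ne_bot _)) (Or.inr (EReal.coe_ne_top _))
  obtain ⟨y, hyb, hymin⟩ := LowerSemicontinuousOn.exists_isMinOn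
    (Metric.nonempty_closedBall.2 hd0 : (Metric.closedBall x d).Nonempty)
    (isCompact_closedBall x d) (hplsc.lowerSemicontinuousOn _)
  have hmin : ∀ z ∈ Metric.closedBall x d, f y + (q y : EReal) ≤ f z + (q z : EReal) :=
    fun z hz => hymin hz
  have hyx := hmin x (Metric.mem_closedBall_self hd0)
  have hqx : q x = 0 := by simp [hq]
  rw [hqx, EReal.coe_zero, add_zero] at hyx
  have hfy : f y ≠ ⊤ := by
    intro h
    rw [h, EReal.top_add_coe, top_le_iff] at hyx
    exact hfx hyx
  obtain ⟨a, ha⟩ : ∃ a : ℝ, f y = a := ⟨_, (EReal.coe_toReal hfy (hbot y)).symm⟩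
  obtain ⟨b, hb⟩ : ∃ b : ℝ, f x = b := ⟨_, (EReal.coe_toReal hfx (hbot x)).symm⟩
  have hsy := hsg y
  rw [ha, hb] at hyx
  rw [hb] at hlt
  rw [ha] at hsy
  norm_cast at hyx hlt hsy
  have hyq : q y = 1 / (2 * κ) * ‖y - x‖ ^ 2 - ⟪v, y - x⟫_ℝ := by rw [hq]
  have hin : ⟪v, y - x₀⟫_ℝ = ⟪v, y - x⟫_ℝ + ⟪v, x - x₀⟫_ℝ := by
    rw [← inner_add_right]; congr 1; abel
  -- Comparison with `x`, and the subgradient at `x₀` as a lower bound for `f y`, leave less than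
  -- `d² / (8κ)` for the penalty. So `y` is interior and the ball constraint is inactive.
  have hyd : 2 * ‖y - x‖ < d := by
    have h1 : 1 / (2 * κ) * ‖y - x‖ ^ 2 < 1 / (8 * κ) * d ^ 2 := by linarith
    have h2 : 1 / (2 * κ) * ‖y - x‖ ^ 2 = 1 / (8 * κ) * (2 * ‖y - x‖) ^ 2 := by
      field_simp; ring
    rw [h2] at h1
    have h3 := lt_of_mul_lt_mul_left h1 (by positivity)
    exact lt_of_pow_lt_pow_left₀ 2 hd0 h3
  set w := v + (1 / κ) • (x - y) with hw
  have hwsub : w ∈ subdiff f y := by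
    intro z
    rw [ha]
    by_cases hz : f z = ⊤
    · rw [hz]; exact le_top
    obtain ⟨c, hc⟩ : ∃ c : ℝ, f z = c := ⟨_, (EReal.coe_toReal hz (hbot z)).symm⟩
    rw [hc]
    norm_cast
    -- Minimality along the segment from `y` to `z`, combined with convexity and divided by `t`;
    -- letting `t → 0` gives the subgradient inequality at `z`.
    have key : ∀ t : ℝ, 0 < t → t ≤ 1 → t * ‖z - y‖ ≤ d / 2 →
        0 ≤ (c - a - ⟪w, z - y⟫_ℝ) + 1 / (2 * κ) * ‖z - y‖ ^ 2 * t := by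
      intro t ht0 ht1 htd
      have hmem : y + t • (z - y) ∈ Metric.closedBall x d := by
        rw [Metric.mem_closedBall, dist_eq_norm]
        have e : y + t • (z - y) - x = (y - x) + t • (z - y) := by abel
        rw [e]
        refine (norm_add_le _ _).trans ?_
        rw [norm_smul, Real.norm_of_nonneg ht0.le]
        linarith
      have h1 := (hmin _ hmem).trans
        (add_le_add_left (hconv.combo_le ha.le hc.le ht0.le ht1) _)
      rw [ha] at h1
      norm_cast at h1
      rw [hyq] at h1
      simp only [hq] at h1
      have e : y + t • (z - y) - x = (y - x) + t • (z - y) := by abel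
      rw [e, norm_add_sq_real, inner_add_right, real_inner_smul_right, real_inner_smul_right,
        norm_smul, Real.norm_of_nonneg ht0.le] at h1
      have e2 : ⟪w, z - y⟫_ℝ = ⟪v, z - y⟫_ℝ - 1 / κ * ⟪y - x, z - y⟫_ℝ := by
        rw [hw, inner_add_left, real_inner_smul_left, ← neg_sub y x, inner_neg_left]; ring
      rw [e2]
      have h2 : 0 ≤ t * ((c - a - (⟪v, z - y⟫_ℝ - 1 / κ * ⟪y - x, z - y⟫_ℝ))
          + 1 / (2 * κ) * ‖z - y‖ ^ 2 * t) := by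
        have e3 : 1 / κ = 1 / (2 * κ) * 2 := by field_simp
        rw [e3]
        nlinarith
      exact nonneg_of_mul_nonneg_right h2 ht0
    have lim : Filter.Tendsto
        (fun t : ℝ => (c - a - ⟪w, z - y⟫_ℝ) + 1 / (2 * κ) * ‖z - y‖ ^ 2 * t)
        (nhdsWithin 0 (Set.Ioi 0)) (nhds (c - a - ⟪w, z - y⟫_ℝ)) := by
      have : Continuous fun t : ℝ => (c - a - ⟪w, z - y⟫_ℝ) + 1 / (2 * κ) * ‖z - y‖ ^ 2 * t := by
        fun_prop
      have h := (this.tendsto 0).mono_left (nhdsWithin_le_nhds (s := Set.Ioi 0))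
      simpa using h
    have hev : ∀ᶠ t : ℝ in nhdsWithin 0 (Set.Ioi 0),
        0 ≤ (c - a - ⟪w, z - y⟫_ℝ) + 1 / (2 * κ) * ‖z - y‖ ^ 2 * t := by
      have h1 : ∀ᶠ t : ℝ in nhdsWithin 0 (Set.Ioi 0), t ≤ 1 :=
        nhdsWithin_le_nhds (eventually_le_nhds (by norm_num))
      have h2 : ∀ᶠ t : ℝ in nhdsWithin 0 (Set.Ioi 0), t * ‖z - y‖ ≤ d / 2 := by
        refine nhdsWithin_le_nhds ?_
        have : Filter.Tendsto (fun t : ℝ => t * ‖z - y‖) (nhds 0) (nhds 0) := by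
          have : Continuous fun t : ℝ => t * ‖z - y‖ := by fun_prop
          simpa using this.tendsto 0
        exact (this.eventually_lt_const (by positivity : 0 < d / 2)).mono fun _ h => h.le
      filter_upwards [h1, h2, self_mem_nhdsWithin] with t ht1 ht2 ht0
      exact key t ht0 ht1 ht2
    have := ge_of_tendsto lim hev
    linarith
  have hwv : ‖w - v‖ = 1 / κ * ‖y - x‖ := by
    rw [hw, add_sub_cancel_left, norm_smul, Real.norm_of_nonneg (by positivity), norm_sub_rev]
  have hyball : y ∈ Metric.closedBall x₀ ε := by
    rw [Metric.mem_closedBall, dist_eq_norm]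
    have : y - x₀ = (y - x) + (x - x₀) := by abel
    rw [this]
    refine (norm_add_le _ _).trans ?_
    linarith [norm_nonneg (y - x)]
  have hle : ‖w - v‖ ≤ δ := by
    rw [hwv, one_div, inv_mul_le_iff₀ hκ]
    linarith [norm_nonneg (y - x)]
  -- The factor `κ` cancels: `dist(y, A) ≤ ‖y - x‖ < d / 2`, whence `dist(x, A) < d`, a
  -- contradiction.
  have h1 := H y hyball hfy w hwsub hle
  rw [hwv, ← mul_assoc, mul_one_div_cancel hκ.ne', one_mul] at h1
  have h2 : d ≤ Metric.infDist y A + dist x y := Metric.infDist_le_infDist_add_dist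
  rw [dist_comm, dist_eq_norm] at h2
  linarith

end Growth

/-! ### Fenchel–Young calculus and metric subregularity. -/

section Conjugate

variable {U : Type*} [NormedAddCommGroup U] [InnerProductSpace ℝ U]

theorem coe_inner_sub_le_conj {p : U → EReal} {x : U} {c : ℝ} (hx : p x = c) (v : U) :
    ((⟪v, x⟫_ℝ - c : ℝ) : EReal) ≤ conj p v := by
  rw [EReal.coe_sub, ← hx]
  exact le_iSup (fun x => ((⟪v, x⟫_ℝ : ℝ) : EReal) - p x) x

theorem IsProper.exists_coe {U : Type*} {p : U → EReal} (hp : IsProper p) : ∃ x, ∃ c : ℝ, p x = c := by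
  obtain ⟨x, hx⟩ := hp.2
  exact ⟨x, _, (EReal.coe_toReal (ne_of_lt hx) (hp.1 x)).symm⟩

theorem IsProper.conj_ne_bot {p : U → EReal} (hp : IsProper p) (v : U) : conj p v ≠ ⊥ := by
  obtain ⟨x, c, hx⟩ := hp.exists_coe
  exact ne_bot_of_le_ne_bot (EReal.coe_ne_bot _) (coe_inner_sub_le_conj hx v)

theorem IsProper.exists_coe_of_subdiff_nonempty {p : U → EReal} (hp : IsProper p) {x v : U}
    (h : v ∈ subdiff p x) : ∃ c : ℝ, p x = c := by
  obtain ⟨y, c, hy⟩ := hp.exists_coe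
  have hx : p x ≠ ⊤ := by
    intro ht
    have := h y
    rw [ht, EReal.top_add_coe, hy, top_le_iff] at this
    exact EReal.coe_ne_top _ this
  exact ⟨_, (EReal.coe_toReal hx (hp.1 x)).symm⟩

/-- The equality case of Fenchel–Young, written as the one inequality that is not automatic. -/
theorem mem_subdiff_iff_conj_le {p : U → EReal} {x v : U} {c : ℝ} (hx : p x = c) :
    v ∈ subdiff p x ↔ conj p v ≤ (⟪v, x⟫_ℝ - c : ℝ) := by
  rw [conj_le_coe_iff]
  refine forall_congr' fun y => ?_
  rw [hx, ← EReal.coe_add, inner_sub_right]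
  have : c + (⟪v, y⟫_ℝ - ⟪v, x⟫_ℝ) = ⟪v, y⟫_ℝ - (⟪v, x⟫_ℝ - c) := by ring
  rw [this]

/-- Isometries leaving a function invariant leave its conjugate invariant. -/
theorem conj_comp_isometryEquiv {p : U → EReal} (w : U ≃ₗᵢ[ℝ] U) (hw : ∀ y, p (w y) = p y)
    (v : U) : conj p (w v) = conj p v := by
  unfold conj
  rw [← w.toEquiv.iSup_comp]
  refine iSup_congr fun x => ?_
  change ((⟪w v, w x⟫_ℝ : ℝ) : EReal) - p (w x) = _
  rw [hw, w.inner_map_map]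

/-- Metric subregularity as an approximate projection property. -/
theorem MetricallySubregularAt.exists_dist_lt {U V : Type*} [NormedAddCommGroup U]
    [NormedAddCommGroup V] {G : U → Set V} {u : U} {v : V} (h : MetricallySubregularAt G u v) :
    ∃ δ > (0 : ℝ), ∃ ε > (0 : ℝ), ∃ κ > (0 : ℝ), ∀ x ∈ Metric.closedBall u ε, ∀ w ∈ G x,
      ‖w - v‖ ≤ δ → ∀ η > 0, ∃ x', v ∈ G x' ∧ ‖x - x'‖ < κ * ‖w - v‖ + η := by
  obtain ⟨-, δ, hδ, ε, hε, κ, hκ, H⟩ := h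
  refine ⟨δ, hδ, ε, hε, κ, hκ, fun x hx w hw hwδ η hη => ?_⟩
  have hmem : w ∈ G x ∩ Metric.closedBall v δ :=
    ⟨hw, by rw [Metric.mem_closedBall, dist_eq_norm]; exact hwδ⟩
  have h1 : Metric.infEDist x {u | v ∈ G u} < ENNReal.ofReal (κ * ‖w - v‖ + η) := by
    refine ((H x hx).trans ?_).trans_lt ((ENNReal.ofReal_lt_ofReal_iff (by positivity)).2
      (lt_add_of_pos_right (κ * ‖w - v‖) hη))
    rw [ENNReal.ofReal_mul hκ.le]
    gcongr
    refine (Metric.infEDist_le_edist_of_mem hmem).trans ?_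
    rw [edist_dist, dist_comm, dist_eq_norm]
  obtain ⟨x', hx', hd⟩ := Metric.infEDist_lt_iff.1 h1
  rw [edist_dist, ENNReal.ofReal_lt_ofReal_iff (by positivity), dist_eq_norm] at hd
  exact ⟨x', hx', hd⟩

end Conjugate

/-! ### Spectral functions: transfer from `g*` to `(g ∘ γ)*`. -/

section Spectral

variable {E : Type*} [NormedAddCommGroup E] [InnerProductSpace ℝ E] {n : ℕ}

/-- The properties of the ordered eigenvalue map, or the singular value map, `γ` with respect to
the set `Φ` of diagonal embeddings of `ℝ^n` that are used in the study of the function `g ∘ γ`. -/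
structure IsSpectralMap (g : EuclideanSpace ℝ (Fin n) → EReal) (γ : E → EuclideanSpace ℝ (Fin n))
    (Φ : Set (EuclideanSpace ℝ (Fin n) →ₗᵢ[ℝ] E)) : Prop where
  exists_frame : ∀ X, ∃ φ ∈ Φ, φ (γ X) = X
  inner_le : ∀ φ ∈ Φ, ∀ X Y, ⟪φ (γ X), Y⟫_ℝ ≤ ⟪γ X, γ Y⟫_ℝ
  invariant : ∀ φ ∈ Φ, ∀ x, ∃ w : EuclideanSpace ℝ (Fin n) ≃ₗᵢ[ℝ] EuclideanSpace ℝ (Fin n),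
    γ (φ x) = w x ∧ ∀ y, g (w y) = g y
  -- Stability of frames: `C` depends on `X` alone, and the error is linear in the failure of `φ` to
  -- diagonalise `X`.
  exists_near_frame : ∀ X, ∃ C : ℝ, ∀ φ ∈ Φ, ∃ ψ ∈ Φ, ψ (γ X) = X ∧
    ∀ u, ‖ψ u - φ u‖ ≤ C * ‖φ (γ X) - X‖ * ‖u‖

namespace IsSpectralMap

variable {g : EuclideanSpace ℝ (Fin n) → EReal} {γ : E → EuclideanSpace ℝ (Fin n)}
  {Φ : Set (EuclideanSpace ℝ (Fin n) →ₗᵢ[ℝ] E)} (hS : IsSpectralMap g γ Φ)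

include hS

theorem norm_map (X : E) : ‖γ X‖ = ‖X‖ := by
  obtain ⟨φ, -, h⟩ := hS.exists_frame X
  rw [← φ.norm_map, h]

theorem inner_le_inner (X Y : E) : ⟪X, Y⟫_ℝ ≤ ⟪γ X, γ Y⟫_ℝ := by
  obtain ⟨φ, hφ, h⟩ := hS.exists_frame X
  simpa [h] using hS.inner_le φ hφ X Y

/-- After expansion of the squares this is the trace inequality, since `γ` preserves norms. -/
theorem norm_map_sub_le (X Y : E) : ‖γ X - γ Y‖ ≤ ‖X - Y‖ := by
  refine le_of_sq_le_sq ?_ (norm_nonneg _)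
  rw [norm_sub_sq_real, norm_sub_sq_real, hS.norm_map, hS.norm_map]
  linarith [hS.inner_le_inner X Y]

theorem apply_frame {φ} (hφ : φ ∈ Φ) (x : EuclideanSpace ℝ (Fin n)) : g (γ (φ x)) = g x := by
  obtain ⟨w, h1, h2⟩ := hS.invariant φ hφ x
  rw [h1, h2]

/-- One inequality is the trace inequality; the other restricts the supremum to points `φ x` for a
frame `φ` of `T`, on which the pairing is that of `ℝ^n`. -/
theorem conj_comp (T : E) : conj (fun X => g (γ X)) T = conj g (γ T) := by
  apply le_antisymm
  · refine iSup_le fun X => ?_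
    refine le_trans ?_ (le_iSup _ (γ X))
    exact EReal.sub_le_sub (EReal.coe_le_coe_iff.2 (hS.inner_le_inner T X)) le_rfl
  · refine iSup_le fun x => ?_
    obtain ⟨φ, hφ, h⟩ := hS.exists_frame T
    refine le_trans (le_of_eq ?_) (le_iSup _ (φ x))
    beta_reduce
    rw [hS.apply_frame hφ]
    conv_rhs => rw [← h]
    rw [φ.inner_map_map]

theorem conj_apply_frame {φ} (hφ : φ ∈ Φ) (x : EuclideanSpace ℝ (Fin n)) :
    conj g (γ (φ x)) = conj g x := by
  obtain ⟨w, h1, h2⟩ := hS.invariant φ hφ x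
  rw [h1, conj_comp_isometryEquiv w h2]

theorem isProper_comp (hg : IsProper g) : IsProper fun X => g (γ X) := by
  refine ⟨fun X => hg.1 _, ?_⟩
  obtain ⟨x, hx⟩ := hg.2
  obtain ⟨φ, hφ, -⟩ := hS.exists_frame 0
  exact ⟨φ x, by simpa [effDom, hS.apply_frame hφ] using hx⟩

/-- The subgradient inequality is tested at `φ u` with `φ` a frame of `X`. At `u = γ T` the finite
values cancel, and equality in the trace inequality is left. -/
theorem mem_subdiff_conj (hg : IsProper g) {X T : E}
    (hX : X ∈ subdiff (conj fun X => g (γ X)) T) (hT : conj (fun X => g (γ X)) T ≠ ⊤) :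
    ⟪X, T⟫_ℝ = ⟪γ X, γ T⟫_ℝ ∧ γ X ∈ subdiff (conj g) (γ T) := by
  obtain ⟨c, hc⟩ : ∃ c : ℝ, conj g (γ T) = c := by
    rw [hS.conj_comp] at hT
    exact ⟨_, (EReal.coe_toReal hT (hg.conj_ne_bot _)).symm⟩
  obtain ⟨φ, hφ, h⟩ := hS.exists_frame X
  have key : ∀ u, ((c + (⟪γ X, u⟫_ℝ - ⟪X, T⟫_ℝ) : ℝ) : EReal) ≤ conj g u := by
    intro u
    have h1 := hX (φ u)
    have h2 : ⟪X, φ u⟫_ℝ = ⟪γ X, u⟫_ℝ := by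
      conv_lhs => rw [← h]
      rw [φ.inner_map_map]
    rwa [hS.conj_comp, hS.conj_comp, hS.conj_apply_frame hφ, hc, inner_sub_right, h2,
      ← EReal.coe_add] at h1
  have heq : ⟪X, T⟫_ℝ = ⟪γ X, γ T⟫_ℝ := by
    refine le_antisymm (hS.inner_le_inner X T) ?_
    have := key (γ T)
    rw [hc, EReal.coe_le_coe_iff] at this
    linarith
  refine ⟨heq, fun u => ?_⟩
  rw [hc, ← EReal.coe_add, inner_sub_right, ← heq]
  exact key u

/-- Simultaneous ordered diagonalization in the case of equality in the trace inequality. -/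
theorem exists_common_frame {X T : E} (h : ⟪X, T⟫_ℝ = ⟪γ X, γ T⟫_ℝ) :
    ∃ φ ∈ Φ, φ (γ X) = X ∧ φ (γ T) = T := by
  -- Both vectors have norm `‖X + T‖`, and the trace inequality bounds their inner product below by
  -- `‖X + T‖²`.
  have hXT : γ (X + T) = γ X + γ T := by
    have h1 : ‖γ (X + T)‖ = ‖X + T‖ := hS.norm_map _
    have h2 : ‖γ X + γ T‖ ^ 2 = ‖X + T‖ ^ 2 := by
      rw [norm_add_sq_real, norm_add_sq_real, hS.norm_map, hS.norm_map, h]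
    have h3 : ‖X + T‖ ^ 2 ≤ ⟪γ (X + T), γ X + γ T⟫_ℝ := by
      rw [← real_inner_self_eq_norm_sq]
      conv_lhs => rw [inner_add_right]
      rw [inner_add_right]
      exact add_le_add (hS.inner_le_inner _ _) (hS.inner_le_inner _ _)
    have h4 : ‖γ (X + T) - (γ X + γ T)‖ ^ 2 ≤ 0 := by
      rw [norm_sub_sq_real, h1, h2]; linarith
    have h5 : ‖γ (X + T) - (γ X + γ T)‖ = 0 := by
      nlinarith [norm_nonneg (γ (X + T) - (γ X + γ T))]
    exact sub_eq_zero.1 (norm_eq_zero.1 h5)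
  obtain ⟨φ, hφ, hφe⟩ := hS.exists_frame (X + T)
  rw [hXT, map_add] at hφe
  -- The pairing of `φ (γ X)` with `X + T` is `‖X‖² + ⟪γ X, γ T⟫`, of which `T` contributes at most
  -- `⟪γ X, γ T⟫`; so its pairing with `X` reaches `‖X‖²`.
  have hX : φ (γ X) = X := by
    have h1 : ⟪φ (γ X), T⟫_ℝ ≤ ⟪γ X, γ T⟫_ℝ := hS.inner_le φ hφ X T
    have h2 : ⟪φ (γ X), X⟫_ℝ + ⟪φ (γ X), T⟫_ℝ = ‖X‖ ^ 2 + ⟪γ X, γ T⟫_ℝ := by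
      rw [← inner_add_right, ← hφe, inner_add_right, φ.inner_map_map, φ.inner_map_map,
        real_inner_self_eq_norm_sq, hS.norm_map]
    have h4 : ‖φ (γ X) - X‖ ^ 2 ≤ 0 := by
      rw [norm_sub_sq_real, φ.norm_map, hS.norm_map]; linarith
    have h5 : ‖φ (γ X) - X‖ = 0 := by nlinarith [norm_nonneg (φ (γ X) - X)]
    exact sub_eq_zero.1 (norm_eq_zero.1 h5)
  refine ⟨φ, hφ, hX, ?_⟩
  rw [hX] at hφe
  exact add_left_cancel hφe

/-- The known subgradient `T₁` takes the place of biconjugation: the inequality for `γ X ∈ ∂g*(u)`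
at `γ T₁`, with Fenchel–Young equality for `T₁`, yields the equality for `u`. -/
theorem frame_mem_subdiff (hg : IsProper g) {X T₁ : E} (hT₁ : T₁ ∈ subdiff (fun X => g (γ X)) X)
    {u : EuclideanSpace ℝ (Fin n)} (hu : γ X ∈ subdiff (conj g) u)
    {ψ} (hψ : ψ ∈ Φ) (hψX : ψ (γ X) = X) : ψ u ∈ subdiff (fun X => g (γ X)) X := by
  have hθ := hS.isProper_comp hg
  obtain ⟨c, hc⟩ := hθ.exists_coe_of_subdiff_nonempty hT₁
  rw [mem_subdiff_iff_conj_le (p := fun X => g (γ X)) hc, hS.conj_comp] at hT₁ ⊢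
  rw [hS.conj_apply_frame hψ]
  have h1 := (hu (γ T₁)).trans hT₁
  have h2 : ⟪ψ u, X⟫_ℝ = ⟪u, γ X⟫_ℝ := by
    conv_lhs => rw [← hψX]
    rw [ψ.inner_map_map]
  rw [h2]
  have h3 := hg.conj_ne_bot u
  induction hu' : conj g u with
  | bot => exact absurd hu' h3
  | top => rw [hu', EReal.top_add_coe, top_le_iff] at h1; exact absurd h1 (EReal.coe_ne_top _)
  | coe a =>
    rw [hu'] at h1
    norm_cast at h1 ⊢
    rw [inner_sub_right, real_inner_comm u, real_inner_comm (γ T₁)] at h1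
    have := hS.inner_le_inner T₁ X
    linarith

/-- Metric subregularity of `∂g*` yields an error bound for `∂(g ∘ γ)*`. -/
theorem subdiff_error_bound (hg : IsProper g) {X T : E}
    (hne : (subdiff (fun X => g (γ X)) X).Nonempty)
    (hsub : MetricallySubregularAt (subdiff (conj g)) (γ T) (γ X)) :
    ∃ δ > (0 : ℝ), ∃ ε > (0 : ℝ), ∃ κ > (0 : ℝ), ∀ T' ∈ Metric.closedBall T ε,
      conj (fun X => g (γ X)) T' ≠ ⊤ → ∀ X' ∈ subdiff (conj fun X => g (γ X)) T',
      ‖X' - X‖ ≤ δ → Metric.infDist T' (subdiff (fun X => g (γ X)) X) ≤ κ * ‖X' - X‖ := by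
  obtain ⟨T₁, hT₁⟩ := hne
  obtain ⟨δ, hδ, ε, hε, κ, hκ, H⟩ := hsub.exists_dist_lt
  obtain ⟨C, hC⟩ := hS.exists_near_frame X
  -- A bound for the norm of the approximate projection `u` found below; the last summand pays for
  -- the slack.
  obtain ⟨R, hR⟩ : ∃ R, R = ‖γ T‖ + ε + κ * δ + 1 := ⟨_, rfl⟩
  have hRpos : 0 < R := by rw [hR]; positivity
  refine ⟨δ, hδ, ε, hε, κ + 2 * |C| * R, by positivity, fun T' hT' hfin X' hX' hXX' => ?_⟩
  obtain ⟨heq, hmem⟩ := hS.mem_subdiff_conj hg hX' hfin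
  obtain ⟨φ, hφ, hφX, hφT⟩ := hS.exists_common_frame heq
  have hd : dist (γ T') (γ T) ≤ ε := by
    rw [dist_eq_norm]
    refine (hS.norm_map_sub_le _ _).trans ?_
    rwa [← dist_eq_norm]
  have hd2 : ‖γ X' - γ X‖ ≤ ‖X' - X‖ := hS.norm_map_sub_le _ _
  refine le_of_forall_pos_le_add fun η hη => ?_
  -- The slack `η` replaces attainment of the distance; the cap at `1` keeps `‖u‖ ≤ R`.
  obtain ⟨u, hu, hud⟩ := H (γ T') hd _ hmem (hd2.trans hXX') (min η 1) (lt_min hη one_pos)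
  have hκ2 : κ * ‖γ X' - γ X‖ ≤ κ * ‖X' - X‖ := by gcongr
  -- The frame `φ` diagonalises `X'`, not `X`, so `φ u` may miss `∂θ(X)`; `ψ` is exact for `X`.
  -- Since `φ (γ X')` is `X'`, the defect `‖φ (γ X) - X‖` is at most `2 ‖X' - X‖`.
  obtain ⟨ψ, hψ, hψX, hψφ⟩ := hC φ hφ
  have hmemψ := hS.frame_mem_subdiff hg hT₁ hu hψ hψX
  refine (Metric.infDist_le_dist_of_mem hmemψ).trans ?_
  have hun : ‖u‖ ≤ R := by
    have e : u = γ T + (γ T' - γ T) - (γ T' - u) := by abel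
    rw [e]
    refine (norm_sub_le _ _).trans ?_
    have := norm_add_le (γ T) (γ T' - γ T)
    rw [dist_eq_norm] at hd
    have h3 : κ * ‖X' - X‖ ≤ κ * δ := by gcongr
    have := min_le_right η 1
    linarith
  have hXn : ‖φ (γ X) - X‖ ≤ 2 * ‖X' - X‖ := by
    have e : φ (γ X) - X = (φ (γ X) - φ (γ X')) + (X' - X) := by rw [hφX]; abel
    rw [e]
    refine (norm_add_le _ _).trans ?_
    rw [← map_sub, φ.norm_map, norm_sub_rev]
    linarith
  have e : T' - ψ u = (φ (γ T') - φ u) - (ψ u - φ u) := by rw [hφT]; abel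
  rw [dist_eq_norm, e]
  refine (norm_sub_le _ _).trans ?_
  rw [← map_sub, φ.norm_map]
  have h4 : ‖ψ u - φ u‖ ≤ |C| * (2 * ‖X' - X‖) * R := by
    refine (hψφ u).trans ?_
    have : C ≤ |C| := le_abs_self C
    gcongr
  have := min_le_left η 1
  linarith

/-- Quadratic growth of the conjugate of a spectral function. -/
theorem conj_quadratic_growth [FiniteDimensional ℝ E] (hg : IsProper g) {X T : E}
    (hX : X ∈ subdiff (conj fun X => g (γ X)) T) (hT : conj (fun X => g (γ X)) T ≠ ⊤)
    (hne : (subdiff (fun X => g (γ X)) X).Nonempty)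
    (hsub : ∀ v ∈ subdiff (conj g) (γ T), MetricallySubregularAt (subdiff (conj g)) (γ T) v) :
    ∃ ε > (0 : ℝ), ∃ c > (0 : ℝ), ∀ T' ∈ Metric.closedBall T ε,
      (((conj (fun X => g (γ X)) T).toReal + ⟪X, T' - T⟫_ℝ
        + c * Metric.infDist T' (subdiff (fun X => g (γ X)) X) ^ 2 : ℝ) : EReal)
        ≤ conj (fun X => g (γ X)) T' := by
  obtain ⟨heq, hmem⟩ := hS.mem_subdiff_conj hg hX hT
  obtain ⟨φ, hφ, hφX, hφT⟩ := hS.exists_common_frame heq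
  obtain ⟨T₁, hT₁⟩ := hne
  have hTX := hS.frame_mem_subdiff hg hT₁ hmem hφ hφX
  rw [hφT] at hTX
  exact quadratic_growth_of_subdiff_error_bound (hS.isProper_comp hg).conj_ne_bot
    (lowerSemicontinuous_conj _) (isConvexFun_conj _) hX hT hTX
    (hS.subdiff_error_bound hg ⟨T₁, hT₁⟩ (hsub _ hmem))

end IsSpectralMap

end Spectral

/-! ### Farkas' lemma and linear growth over polyhedral cones. -/

section Polyhedral

variable {U : Type*} [NormedAddCommGroup U] [InnerProductSpace ℝ U]

/-- Farkas' lemma. -/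
theorem exists_nonneg_combination {k : ℕ} (a : Fin k → U) (y : U)
    (h : ∀ x, (∀ i, 0 ≤ ⟪a i, x⟫_ℝ) → 0 ≤ ⟪y, x⟫_ℝ) :
    ∃ t : Fin k → ℝ, (∀ i, 0 ≤ t i) ∧ y = ∑ i, t i • a i := by
  induction k generalizing y with
  | zero =>
    have := h (-y) (fun i => i.elim0)
    rw [inner_neg_right, real_inner_self_eq_norm_sq] at this
    have h0 : ‖y‖ = 0 := by nlinarith [norm_nonneg y]
    exact ⟨0, fun _ => le_rfl, by simpa using h0⟩
  | succ k ih =>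
    by_cases hy : ∀ x, (∀ i : Fin k, 0 ≤ ⟪a i.castSucc, x⟫_ℝ) → 0 ≤ ⟪y, x⟫_ℝ
    · obtain ⟨t, ht, rfl⟩ := ih (fun i => a i.castSucc) y hy
      refine ⟨Fin.snoc t 0, fun i => ?_, by simp [Fin.sum_univ_castSucc]⟩
      refine Fin.lastCases ?_ (fun j => ?_) i
      · simp
      · simpa using ht j
    · push Not at hy
      obtain ⟨x₀, hx₀, hyx₀⟩ := hy
      obtain ⟨l, hl⟩ : ∃ l, l = a (Fin.last k) := ⟨_, rfl⟩
      have hlneg : ⟪l, x₀⟫_ℝ < 0 := by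
        by_contra hcon
        refine absurd (h x₀ fun i => ?_) (not_le.2 hyx₀)
        refine Fin.lastCases ?_ (fun j => hx₀ j) i
        rw [← hl]; exact not_lt.1 hcon
      -- Vectors are projected along `l` onto the complement of `x₀`. The adjoint projection maps
      -- into the complement of `l`, so the last constraint holds with equality and `h` applies.
      obtain ⟨t, ht, hsum⟩ := ih
        (fun i => a i.castSucc - (⟪a i.castSucc, x₀⟫_ℝ / ⟪l, x₀⟫_ℝ) • l)
        (y - (⟪y, x₀⟫_ℝ / ⟪l, x₀⟫_ℝ) • l) (by
          intro x hx
          have key : ∀ z : U, ⟪z - (⟪z, x₀⟫_ℝ / ⟪l, x₀⟫_ℝ) • l, x⟫_ℝ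
              = ⟪z, x - (⟪l, x⟫_ℝ / ⟪l, x₀⟫_ℝ) • x₀⟫_ℝ := by
            intro z
            rw [inner_sub_left, inner_sub_right, real_inner_smul_left, real_inner_smul_right]
            ring
          rw [key]
          refine h _ fun i => ?_
          refine Fin.lastCases ?_ (fun j => ?_) i
          · rw [← hl, inner_sub_right, real_inner_smul_right, div_mul_cancel₀ _ hlneg.ne, sub_self]
          · rw [← key]; exact hx j)
      refine ⟨Fin.snoc t (⟪y, x₀⟫_ℝ / ⟪l, x₀⟫_ℝ
        + ∑ i, t i * (⟪a i.castSucc, x₀⟫_ℝ / -⟪l, x₀⟫_ℝ)), fun i => ?_, ?_⟩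
      · refine Fin.lastCases ?_ (fun j => ?_) i
        · rw [Fin.snoc_last]
          refine add_nonneg (div_nonneg_of_nonpos hyx₀.le hlneg.le)
            (Finset.sum_nonneg fun j _ => mul_nonneg (ht j) (div_nonneg (hx₀ j) ?_))
          linarith
        · simpa using ht j
      · rw [sub_eq_iff_eq_add] at hsum
        conv_lhs => rw [hsum]
        rw [Fin.sum_univ_castSucc]
        simp only [Fin.snoc_castSucc, Fin.snoc_last, ← hl, smul_sub, Finset.sum_sub_distrib,
          add_smul, Finset.sum_smul, div_neg, mul_neg, neg_smul, Finset.sum_neg_distrib, mul_smul]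
        abel

/-- Linear growth over the dual of a polyhedral cone. -/
theorem IsPolyhedralCone.linear_growth {Q : Set U} (hQ : IsPolyhedralCone Q) {D : Set U}
    (hD : D = {y | ∀ q ∈ Q, 0 ≤ ⟪y, q⟫_ℝ}) {v y₀ : U} (hv : v ∈ normalCone D y₀) :
    ∃ c > (0 : ℝ), ∀ y ∈ D, c * Metric.infDist y {y | v ∈ normalCone D y} ≤ ⟪v, y₀ - y⟫_ℝ := by
  obtain ⟨k, a, rfl⟩ := hQ
  obtain ⟨hy₀, hv⟩ := hv
  have hsmul : ∀ t : ℝ, 0 ≤ t → ∀ y ∈ D, t • y ∈ D := by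
    rw [hD]
    intro t ht y hy q hq
    rw [real_inner_smul_left]
    exact mul_nonneg ht (hy q hq)
  -- Comparison of `y₀` with `0` and `2 y₀`, both in the cone.
  have hzero : ⟪v, y₀⟫_ℝ = 0 := by
    have h1 := hv _ (hsmul 0 le_rfl y₀ hy₀)
    have h2 := hv _ (hsmul 2 (by norm_num) y₀ hy₀)
    rw [inner_sub_right, real_inner_smul_right] at h1 h2
    linarith
  have hle : ∀ y ∈ D, ⟪v, y⟫_ℝ ≤ 0 := by
    intro y hy
    have := hv y hy
    rw [inner_sub_right, hzero] at this
    linarith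
  have haD : ∀ i, a i ∈ D := by
    rw [hD]
    exact fun i q hq => hq i
  have hc : ∃ c > (0 : ℝ), ∀ i, ⟪v, a i⟫_ℝ < 0 → c * ‖a i‖ ≤ -⟪v, a i⟫_ℝ := by
    have : ∀ᶠ c : ℝ in nhdsWithin 0 (Set.Ioi 0), ∀ i, ⟪v, a i⟫_ℝ < 0 → c * ‖a i‖ ≤ -⟪v, a i⟫_ℝ := by
      rw [Filter.eventually_all]
      intro i
      by_cases hi : ⟪v, a i⟫_ℝ < 0
      · refine nhdsWithin_le_nhds ?_
        have hcont : Continuous fun t : ℝ => t * ‖a i‖ := by fun_prop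
        have := hcont.tendsto 0
        rw [zero_mul] at this
        exact (this.eventually_lt_const (neg_pos.2 hi)).mono fun _ h _ => h.le
      · exact Filter.Eventually.of_forall fun _ h => absurd h hi
    obtain ⟨c, hc, hc0⟩ := (this.and self_mem_nhdsWithin).exists
    exact ⟨c, hc0, hc⟩
  obtain ⟨c, hc0, hc⟩ := hc
  refine ⟨c, hc0, fun y hy => ?_⟩
  obtain ⟨t, ht, hyt⟩ := exists_nonneg_combination a y (by
    rw [hD] at hy
    exact fun x hx => hy x hx)
  -- Dropping the generators with `⟪v, a i⟫ < 0` leaves a point of the face `D ∩ v^⊥`; by the choice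
  -- of `c`, the dropped part has norm at most `-⟪v, y⟫ / c`.
  have hmem : (∑ i, (if ⟪v, a i⟫_ℝ < 0 then 0 else t i) • a i) ∈ {y | v ∈ normalCone D y} := by
    have h0 : ⟪v, ∑ i, (if ⟪v, a i⟫_ℝ < 0 then 0 else t i) • a i⟫_ℝ = 0 := by
      rw [inner_sum]
      refine Finset.sum_eq_zero fun i _ => ?_
      rw [real_inner_smul_right]
      split_ifs with h
      · simp
      · rw [le_antisymm (hle _ (haD i)) (not_lt.1 h), mul_zero]
    refine ⟨?_, fun u hu => ?_⟩
    · rw [hD]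
      intro q hq
      rw [sum_inner]
      refine Finset.sum_nonneg fun i _ => ?_
      rw [real_inner_smul_left]
      refine mul_nonneg ?_ (hq i)
      split_ifs
      exacts [le_rfl, ht i]
    · rw [inner_sub_right, h0, sub_zero]
      exact hle u hu
  have hd := Metric.infDist_le_dist_of_mem (x := y) hmem
  refine (mul_le_mul_of_nonneg_left hd hc0.le).trans ?_
  rw [inner_sub_right, hzero, zero_sub, dist_eq_norm]
  have hsub : y - ∑ i, (if ⟪v, a i⟫_ℝ < 0 then 0 else t i) • a i
      = ∑ i, (if ⟪v, a i⟫_ℝ < 0 then t i else 0) • a i := by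
    conv_lhs => rw [hyt]
    rw [← Finset.sum_sub_distrib]
    refine Finset.sum_congr rfl fun i _ => ?_
    split_ifs <;> simp
  have hinner : -⟪v, y⟫_ℝ = ∑ i, t i * -⟪v, a i⟫_ℝ := by
    rw [hyt, inner_sum, ← Finset.sum_neg_distrib]
    exact Finset.sum_congr rfl fun i _ => by rw [real_inner_smul_right]; ring
  rw [hsub, hinner]
  refine (mul_le_mul_of_nonneg_left (norm_sum_le _ _) hc0.le).trans ?_
  rw [Finset.mul_sum]
  refine Finset.sum_le_sum fun i _ => ?_
  split_ifs with h
  · rw [norm_smul, Real.norm_of_nonneg (ht i)]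
    have := mul_le_mul_of_nonneg_left (hc i h) (ht i)
    linarith
  · rw [zero_smul, norm_zero, mul_zero]
    exact mul_nonneg (ht i) (neg_nonneg.2 (hle _ (haD i)))

end Polyhedral

/-! ### Quadratic growth from local strong convexity. -/

section StrongConvexity

variable {U : Type*} [NormedAddCommGroup U] [InnerProductSpace ℝ U] [FiniteDimensional ℝ U]

theorem IsStronglyConvexOnCompacts.quadratic_growth {p : U → EReal}
    (hp : IsStronglyConvexOnCompacts p) (hopen : IsOpen (effDom p)) (hbot : ∀ x, p x ≠ ⊥)
    {u v : U} (hv : v ∈ subdiff p u) (hu : p u ≠ ⊤) :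
    ∃ ε > (0 : ℝ), ∃ c > (0 : ℝ), ∀ x ∈ Metric.closedBall u ε,
      (((p u).toReal + ⟪v, x - u⟫_ℝ + c * ‖x - u‖ ^ 2 : ℝ) : EReal) ≤ p x := by
  obtain ⟨ε, hε, hball⟩ := Metric.nhds_basis_closedBall.mem_iff.1
    (hopen.mem_nhds (lt_top_iff_ne_top.2 hu : u ∈ effDom p))
  obtain ⟨μ, hμ, hsc⟩ := hp _ hball (isCompact_closedBall u ε) (convex_closedBall u ε)
  refine ⟨ε, hε, μ / 4, by positivity, fun x hx => ?_⟩
  -- At the midpoint strong convexity gains `μ / 8 * ‖x - u‖²`; the subgradient inequality there,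
  -- after doubling, gives `μ / 4`.
  have hmid := hsc.2 (Metric.mem_closedBall_self hε.le) hx
    (by norm_num : (0 : ℝ) ≤ 1 / 2) (by norm_num : (0 : ℝ) ≤ 1 / 2) (by norm_num)
  have hmem := hsc.1 (Metric.mem_closedBall_self hε.le) hx
    (by norm_num : (0 : ℝ) ≤ 1 / 2) (by norm_num : (0 : ℝ) ≤ 1 / 2) (by norm_num)
  have hsub := toReal_of_mem_subdiff hv hbot hu ((1 / 2 : ℝ) • u + (1 / 2 : ℝ) • x)
  have hreal : ∀ z ∈ Metric.closedBall u ε, p z = ((p z).toReal : EReal) := fun z hz =>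
    (EReal.coe_toReal (ne_of_lt (hball hz)) (hbot z)).symm
  rw [hreal _ hmem, EReal.coe_le_coe_iff] at hsub
  rw [hreal x hx, EReal.coe_le_coe_iff]
  have e : (1 / 2 : ℝ) • u + (1 / 2 : ℝ) • x - u = (1 / 2 : ℝ) • (x - u) := by module
  rw [e, real_inner_smul_right] at hsub
  simp only [smul_eq_mul] at hmid
  rw [norm_sub_rev] at hmid
  linarith

end StrongConvexity

/-- Meant for cylinders: moving a single component of `Z` realises the distance of that component to
the base. -/
theorem infDist_le_infDist_of_lift {α β : Type*} [PseudoMetricSpace α] [PseudoMetricSpace β]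
    {A : Set α} {B : Set β} (x : α) (y : β) (hB : B.Nonempty)
    (h : ∀ b ∈ B, ∃ a ∈ A, dist x a = dist y b) : Metric.infDist x A ≤ Metric.infDist y B := by
  rw [Metric.le_infDist hB]
  intro b hb
  obtain ⟨a, ha, hd⟩ := h b hb
  rw [← hd]
  exact Metric.infDist_le_dist_of_mem ha

/-! ### Growth of the dual objective. -/

section Dual

variable {E : Type} [NormedAddCommGroup E] [InnerProductSpace ℝ E] {d e : ℕ}

theorem DualVar.norm_y_le (Z : DualVar E d e) : ‖Z.y‖ ≤ ‖Z‖ := WithLp.norm_fst_le _ _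

theorem DualVar.norm_w_le (Z : DualVar E d e) : ‖Z.w‖ ≤ ‖Z‖ :=
  (WithLp.norm_fst_le _ _).trans (WithLp.norm_snd_le _ _)

theorem DualVar.norm_S_le (Z : DualVar E d e) : ‖Z.S‖ ≤ ‖Z‖ :=
  (WithLp.norm_snd_le _ _).trans (WithLp.norm_snd_le _ _)

theorem infDist_GD2_le (Z : DualVar E d e) (w : EuclideanSpace ℝ (Fin d)) :
    Metric.infDist Z (GD2 w) ≤ ‖Z.w - w‖ := by
  have hmem : (WithLp.toLp 2 (Z.fst, WithLp.toLp 2 (w, Z.snd.snd)) : DualVar E d e) ∈ GD2 w := rfl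
  refine (Metric.infDist_le_dist_of_mem hmem).trans (le_of_eq ?_)
  rw [WithLp.prod_dist_eq_of_L2, WithLp.prod_dist_eq_of_L2]
  simp [DualVar.w, dist_eq_norm, Real.sqrt_sq (norm_nonneg _)]

namespace Problem

variable (P : Problem E d e)

theorem infDist_GD1_le (Z : DualVar E d e) {X : E}
    (h : {y | P.b - P.A X ∈ normalCone P.dualCone y}.Nonempty) :
    Metric.infDist Z (P.GD1 X) ≤
      Metric.infDist Z.y {y | P.b - P.A X ∈ normalCone P.dualCone y} := by
  refine infDist_le_infDist_of_lift Z Z.y h fun b hb => ⟨WithLp.toLp 2 (b, Z.snd), hb, ?_⟩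
  rw [WithLp.prod_dist_eq_of_L2]
  simp [DualVar.y, Real.sqrt_sq dist_nonneg]

theorem infDist_GD3_le (Z : DualVar E d e) {X : E} (h : (subdiff P.θ X).Nonempty) :
    Metric.infDist Z (P.GD3 X) ≤ Metric.infDist (-Z.S) (subdiff P.θ X) := by
  refine infDist_le_infDist_of_lift Z (-Z.S) h fun b hb =>
    ⟨WithLp.toLp 2 (Z.fst, WithLp.toLp 2 (Z.snd.fst, -b)), ?_, ?_⟩
  · change -(-b) ∈ subdiff P.θ X
    rwa [neg_neg]
  · rw [WithLp.prod_dist_eq_of_L2, WithLp.prod_dist_eq_of_L2, ← neg_neg b, dist_neg_neg]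
    simp [DualVar.S, Real.sqrt_sq dist_nonneg]

theorem dualObj_eq_of_mem {Z : DualVar E d e} (hy : Z.y ∈ P.dualCone) :
    P.dualObj Z = ((-⟪P.b, Z.y⟫_ℝ : ℝ) : EReal) + conj P.h (-Z.w) + conj P.θ (-Z.S) := by
  simp [dualObj, indicatorFun, hy]

variable [FiniteDimensional ℝ E]

/-- The constraint enters only here: the linear parts of the three subgradient inequalities depend
on `Z` through `⟪b, y⟫` alone. -/
theorem inner_multiplier_eq {Z : DualVar E d e} (hZ : Z ∈ P.VD) (X : E) :
    ⟪P.b - P.A X, Z.y⟫_ℝ + ⟪P.F X, -Z.w⟫_ℝ + ⟪X, -Z.S⟫_ℝ = ⟪P.b, Z.y⟫_ℝ - ⟪X, P.C⟫_ℝ := by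
  have h : LinearMap.adjoint P.A Z.y + LinearMap.adjoint P.F Z.w + Z.S = P.C := hZ
  rw [← h, inner_add_right, inner_add_right, LinearMap.adjoint_inner_right,
    LinearMap.adjoint_inner_right, inner_sub_left, inner_neg_right, inner_neg_right]
  ring

/-- With `w` fixed the `h*` terms agree. Fenchel–Young is an equality at `-S` and an inequality at
`-S̄`, and the normal cone condition compares `y` with `ȳ`; so the value does not exceed the optimal
one. -/
theorem mem_dualSolutions_of_mem_inter {Zbar : DualVar E d e} {X : E}
    (hθ : IsProper P.θ) (hZ : Zbar ∈ P.dualSolutions) {Z : DualVar E d e}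
    (hV : Z ∈ P.VD) (h1 : Z ∈ P.GD1 X) (h2 : Z ∈ GD2 Zbar.w) (h3 : Z ∈ P.GD3 X) :
    Z ∈ P.dualSolutions := by
  obtain ⟨⟨hVbar, hybar⟩, hfin, hopt⟩ := hZ
  have hw : Z.w = Zbar.w := h2
  have hy : Z.y ∈ P.dualCone := h1.1
  have hle : P.dualObj Z ≤ P.dualObj Zbar := by
    obtain ⟨c, hc⟩ := hθ.exists_coe_of_subdiff_nonempty h3
    rw [dualObj_eq_of_mem P hy, dualObj_eq_of_mem P hybar, hw]
    have h4 : conj P.θ (-Z.S) ≤ (⟪-Z.S, X⟫_ℝ - c : ℝ) := (mem_subdiff_iff_conj_le hc).1 h3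
    have h5 := coe_inner_sub_le_conj hc (-Zbar.S)
    have h6 := h1.2 _ hybar
    have h7 := P.inner_multiplier_eq hV X
    have h8 := P.inner_multiplier_eq hVbar X
    rw [hw] at h7
    have h9 : (-⟪P.b, Z.y⟫_ℝ) + (⟪-Z.S, X⟫_ℝ - c) ≤
        (-⟪P.b, Zbar.y⟫_ℝ) + (⟪-Zbar.S, X⟫_ℝ - c) := by
      rw [inner_sub_right] at h6
      rw [real_inner_comm X, real_inner_comm X]
      linarith
    rw [add_right_comm, add_right_comm _ (conj P.h _)]
    refine add_le_add_left ?_ _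
    refine (add_le_add_right h4 _).trans (le_trans ?_ (add_le_add_right h5 _))
    rw [← EReal.coe_add, ← EReal.coe_add]
    exact EReal.coe_le_coe_iff.2 h9
  exact ⟨⟨hV, hy⟩, hle.trans_lt hfin, fun Z' hZ' => hle.trans (hopt Z' hZ')⟩

/-- The dual objective grows quadratically away from each of the sets whose intersection is
contained in the set of optimal solutions. -/
theorem dualObj_growth {Zbar : DualVar E d e} {X : E}
    (hP : P.IsAdmissible) (hθ : IsProper P.θ)
    (hZ : Zbar ∈ P.dualSolutions) (hX : X ∈ P.dualMultipliers Zbar)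
    (hC1 : IsC1OnOpenDomain (conj P.h)) (hsc : IsStronglyConvexOnCompacts (conj P.h))
    (hgrowth : ∃ ε > (0 : ℝ), ∃ c > (0 : ℝ), ∀ T ∈ Metric.closedBall (-Zbar.S) ε,
      (((conj P.θ (-Zbar.S)).toReal + ⟪X, T - -Zbar.S⟫_ℝ
        + c * Metric.infDist T (subdiff P.θ X) ^ 2 : ℝ) : EReal) ≤ conj P.θ T)
    (hne : (subdiff P.θ X).Nonempty) :
    ∃ ε > (0 : ℝ), ∃ c > (0 : ℝ), ∀ Z ∈ P.dualFeasible ∩ Metric.closedBall Zbar ε,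
      ∀ i, P.dualObj Zbar + ((c * Metric.infDist Z
        (![P.VD, P.GD1 X, GD2 Zbar.w, P.GD3 X] i) ^ 2 : ℝ) : EReal) ≤ P.dualObj Z := by
  obtain ⟨⟨hVbar, hybar⟩, hfin, -⟩ := hZ
  obtain ⟨hX1, hX2, hX3, -⟩ := hX
  rw [dualObj_eq_of_mem P hybar] at hfin
  have hhbot := hP.h_proper.conj_ne_bot
  have hθbot := hθ.conj_ne_bot
  obtain ⟨hb, hhb⟩ : ∃ a : ℝ, conj P.h (-Zbar.w) = a := by
    refine ⟨_, (EReal.coe_toReal (fun h => ?_) (hhbot _)).symm⟩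
    rw [h, EReal.coe_add_top, EReal.top_add_of_ne_bot (hθbot _)] at hfin
    exact lt_irrefl _ hfin
  obtain ⟨tb, htb⟩ : ∃ a : ℝ, conj P.θ (-Zbar.S) = a := by
    refine ⟨_, (EReal.coe_toReal (fun h => ?_) (hθbot _)).symm⟩
    rw [h, hhb, ← EReal.coe_add, EReal.coe_add_top] at hfin
    exact lt_irrefl _ hfin
  obtain ⟨c₁, hc₁, H1⟩ := hP.polyhedral.linear_growth (D := P.dualCone) rfl hX1
  obtain ⟨ε₂, hε₂, c₂, hc₂, H2⟩ := hsc.quadratic_growth hC1.isOpen hhbot hX2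
    (by rw [hhb]; exact EReal.coe_ne_top _)
  obtain ⟨ε₃, hε₃, c₃, hc₃, H3⟩ := hgrowth
  rw [htb, EReal.toReal_coe] at H3
  rw [hhb, EReal.toReal_coe] at H2
  obtain ⟨c, hc⟩ : ∃ c, c = min c₁ (min c₂ c₃) := ⟨_, rfl⟩
  have hcpos : 0 < c := by rw [hc]; positivity
  -- Radius at most `1` gives `d₁ ≤ 1` below, so linear growth in `d₁` dominates `d₁²`.
  refine ⟨min 1 (min ε₂ ε₃), by positivity, c, hcpos, ?_⟩
  rintro Z ⟨⟨hV, hy⟩, hball⟩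
  rw [Metric.mem_closedBall, dist_eq_norm, le_min_iff, le_min_iff] at hball
  obtain ⟨hn1, hn2, hn3⟩ := hball
  have hyn : ‖Z.y - Zbar.y‖ ≤ 1 := (DualVar.norm_y_le (Z - Zbar)).trans hn1
  have hwn : ‖Z.w - Zbar.w‖ ≤ ε₂ := (DualVar.norm_w_le (Z - Zbar)).trans hn2
  have hSn : ‖Z.S - Zbar.S‖ ≤ ε₃ := (DualVar.norm_S_le (Z - Zbar)).trans hn3
  have G1 := H1 _ hy
  have G2 := H2 (-Z.w) (by
    rwa [Metric.mem_closedBall, dist_neg_neg, dist_eq_norm])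
  have G3 := H3 (-Z.S) (by
    rwa [Metric.mem_closedBall, dist_neg_neg, dist_eq_norm])
  rw [dualObj_eq_of_mem P hy, dualObj_eq_of_mem P hybar, hhb, htb]
  intro i
  generalize hr : Metric.infDist Z (![P.VD, P.GD1 X, GD2 Zbar.w, P.GD3 X] i) = r
  induction hZh : conj P.h (-Z.w) with
  | bot => exact absurd hZh (hhbot _)
  | top =>
    rw [EReal.coe_add_top, EReal.top_add_of_ne_bot (hθbot _)]
    exact le_top
  | coe h =>
    induction hZt : conj P.θ (-Z.S) with
    | bot => exact absurd hZt (hθbot _)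
    | top =>
      have htop : ((-⟪P.b, Z.y⟫_ℝ : ℝ) : EReal) + (h : EReal) + ⊤ = ⊤ := by
        rw [← EReal.coe_add, EReal.coe_add_top]
      rw [htop]
      exact le_top
    | coe t =>
      rw [hZh, EReal.coe_le_coe_iff] at G2
      rw [hZt, EReal.coe_le_coe_iff] at G3
      norm_cast
      have h7 := P.inner_multiplier_eq hV X
      have h8 := P.inner_multiplier_eq hVbar X
      rw [inner_sub_right] at G1 G2 G3
      obtain ⟨d₁, hd₁⟩ : ∃ d₁, d₁ = Metric.infDist Z.y {y | P.b - P.A X ∈ normalCone P.dualCone y} :=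
        ⟨_, rfl⟩
      obtain ⟨d₃, hd₃⟩ : ∃ d₃, d₃ = Metric.infDist (-Z.S) (subdiff P.θ X) := ⟨_, rfl⟩
      have hw' : ‖-Z.w - -Zbar.w‖ = ‖Z.w - Zbar.w‖ := by
        rw [← norm_neg]; congr 1; abel
      rw [← hd₁] at G1
      rw [← hd₃] at G3
      rw [hw'] at G2
      have hd₁0 : 0 ≤ d₁ := by rw [hd₁]; exact Metric.infDist_nonneg
      have hd₁1 : d₁ ≤ 1 := by
        rw [hd₁]
        refine (Metric.infDist_le_dist_of_mem (show Zbar.y ∈ _ from hX1)).trans ?_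
        rwa [dist_eq_norm]
      have hd₁sq : d₁ ^ 2 ≤ d₁ := pow_le_of_le_one hd₁0 hd₁1 two_ne_zero
      have p1 : 0 ≤ c₁ * d₁ := by positivity
      have p2 : 0 ≤ c₂ * ‖Z.w - Zbar.w‖ ^ 2 := by positivity
      have p3 : 0 ≤ c₃ * d₃ ^ 2 := by positivity
      have hcc1 : c ≤ c₁ := hc ▸ min_le_left _ _
      have hcc2 : c ≤ c₂ := hc ▸ (min_le_right _ _).trans (min_le_left _ _)
      have hcc3 : c ≤ c₃ := hc ▸ (min_le_right _ _).trans (min_le_right _ _)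
      have q1 := mul_le_mul hcc1 hd₁sq (by positivity) hc₁.le
      have q2 := mul_le_mul_of_nonneg_right hcc2 (sq_nonneg ‖Z.w - Zbar.w‖)
      have q3 := mul_le_mul_of_nonneg_right hcc3 (sq_nonneg d₃)
      have hr0 : 0 ≤ r := hr ▸ Metric.infDist_nonneg
      -- In the sum of `G1`, `G2`, `G3` the identities `h7`, `h8` cancel all linear terms.
      suffices c * r ^ 2 ≤ c₁ * d₁ + c₂ * ‖Z.w - Zbar.w‖ ^ 2 + c₃ * d₃ ^ 2 by linarith
      have mono : ∀ s, r ≤ s → c * r ^ 2 ≤ c * s ^ 2 := fun s hs => by gcongr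
      fin_cases i
      · have hr' : Metric.infDist Z P.VD = r := hr
        rw [Metric.infDist_zero_of_mem hV] at hr'
        rw [← hr']
        linarith
      · have hr' : Metric.infDist Z (P.GD1 X) = r := hr
        have := mono d₁ (by rw [hd₁, ← hr']; exact P.infDist_GD1_le Z ⟨Zbar.y, hX1⟩)
        linarith
      · have hr' : Metric.infDist Z (GD2 Zbar.w) = r := hr
        have := mono ‖Z.w - Zbar.w‖ (by rw [← hr']; exact infDist_GD2_le Z _)
        linarith
      · have hr' : Metric.infDist Z (P.GD3 X) = r := hr
        have := mono d₃ (by rw [hd₃, ← hr']; exact P.infDist_GD3_le Z hne)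
        linarith

/-- Quadratic growth of the dual problem from quadratic growth of `θ*`. -/
theorem dualQuadraticGrowthAt_of_conj_growth {Zbar : DualVar E d e} {X : E}
    (hP : P.IsAdmissible) (hθ : IsProper P.θ)
    (hZ : Zbar ∈ P.dualSolutions) (hX : X ∈ P.dualMultipliers Zbar)
    (hC1 : IsC1OnOpenDomain (conj P.h)) (hsc : IsStronglyConvexOnCompacts (conj P.h))
    (hgrowth : ∃ ε > (0 : ℝ), ∃ c > (0 : ℝ), ∀ T ∈ Metric.closedBall (-Zbar.S) ε,
      (((conj P.θ (-Zbar.S)).toReal + ⟪X, T - -Zbar.S⟫_ℝ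
        + c * Metric.infDist T (subdiff P.θ X) ^ 2 : ℝ) : EReal) ≤ conj P.θ T)
    (hblr : BoundedlyLinearlyRegular ![P.VD, P.GD1 X, GD2 Zbar.w, P.GD3 X]) :
    P.DualQuadraticGrowthAt Zbar := by
  obtain ⟨⟨Z₀, hZ₀⟩, hreg⟩ := hblr
  have hinter : ⋂ i, ![P.VD, P.GD1 X, GD2 Zbar.w, P.GD3 X] i ⊆ P.dualSolutions := by
    intro Z h
    rw [Set.mem_iInter] at h
    exact P.mem_dualSolutions_of_mem_inter hθ hZ (h 0) (h 1) (h 2) (h 3)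
  have hne : (subdiff P.θ X).Nonempty := ⟨_, Set.mem_iInter.1 hZ₀ 3⟩
  obtain ⟨ε, hε, c, hc, H⟩ := P.dualObj_growth hP hθ hZ hX hC1 hsc hgrowth hne
  obtain ⟨κ, hκ, Hreg⟩ := hreg (Metric.closedBall Zbar ε) Metric.isBounded_closedBall
  refine ⟨ε, hε, c / κ ^ 2, by positivity, fun Z hZ' => ?_⟩
  -- The growth bound is used only for the set farthest from `Z`, which realises the maximum in the
  -- regularity estimate.
  obtain ⟨i, hi⟩ := exists_eq_ciSup_of_finite
    (f := fun i => Metric.infDist Z (![P.VD, P.GD1 X, GD2 Zbar.w, P.GD3 X] i))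
  have h1 : Metric.infDist Z P.dualSolutions ≤
      κ * Metric.infDist Z (![P.VD, P.GD1 X, GD2 Zbar.w, P.GD3 X] i) := by
    refine (Metric.infDist_le_infDist_of_subset hinter ⟨Z₀, hZ₀⟩).trans ?_
    rw [hi]
    exact Hreg Z hZ'.2
  refine le_trans (add_le_add_right (EReal.coe_le_coe_iff.2 ?_) _) (H Z hZ' i)
  generalize Metric.infDist Z (![P.VD, P.GD1 X, GD2 Zbar.w, P.GD3 X] i) = r at h1
  calc c / κ ^ 2 * Metric.infDist Z P.dualSolutions ^ 2
      ≤ c / κ ^ 2 * (κ * r) ^ 2 := by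
        have := Metric.infDist_nonneg (x := Z) (s := P.dualSolutions)
        gcongr
    _ = c * r ^ 2 := by field_simp

/-- Quadratic growth of the dual problem if `θ = g ∘ γ` is a spectral function. -/
theorem dualQuadraticGrowthAt_of_isSpectralMap {n : ℕ} {g : EuclideanSpace ℝ (Fin n) → EReal}
    {γ : E → EuclideanSpace ℝ (Fin n)} {Φ : Set (EuclideanSpace ℝ (Fin n) →ₗᵢ[ℝ] E)}
    (hS : IsSpectralMap g γ Φ) (hg : IsProper g) (hP : P.IsAdmissible)
    (hθ : ∀ X, P.θ X = g (γ X)) {Zbar : DualVar E d e} (hZ : Zbar ∈ P.dualSolutions)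
    (hC1 : IsC1OnOpenDomain (conj P.h)) (hsc : IsStronglyConvexOnCompacts (conj P.h))
    (hsub : ∀ v ∈ subdiff (conj g) (γ (-Zbar.S)),
      MetricallySubregularAt (subdiff (conj g)) (γ (-Zbar.S)) v)
    (hreg : ∃ X ∈ P.dualMultipliers Zbar,
      BoundedlyLinearlyRegular ![P.VD, P.GD1 X, GD2 Zbar.w, P.GD3 X]) :
    P.DualQuadraticGrowthAt Zbar := by
  obtain ⟨X, hX, hreg⟩ := hreg
  have hθ' : P.θ = fun X => g (γ X) := funext hθ
  have hproper : IsProper P.θ := hθ' ▸ hS.isProper_comp hg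
  refine P.dualQuadraticGrowthAt_of_conj_growth hP hproper hZ hX hC1 hsc ?_ hreg
  obtain ⟨⟨Z₀, hZ₀⟩, -⟩ := hreg
  rw [Set.mem_iInter] at hZ₀
  have hne : (subdiff P.θ X).Nonempty := ⟨_, hZ₀ 3⟩
  have hfin : conj P.θ (-Zbar.S) ≠ ⊤ := by
    intro h
    have := hZ.2.1
    rw [dualObj_eq_of_mem P hZ.1.2, h, EReal.add_top_of_ne_bot] at this
    · exact lt_irrefl _ this
    · simpa [EReal.add_eq_bot_iff] using hP.h_proper.conj_ne_bot _
  have hmem := hX.2.2.1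
  rw [hθ'] at hne hfin hmem ⊢
  exact hS.conj_quadratic_growth hg hmem hfin hne hsub

end Problem

end Dual

/-! ### A linear error bound for commuting orthogonal matrices. -/

section OrthogonalStabilizer

open Matrix Filter Topology
open scoped Matrix.Norms.Frobenius

variable {N : Type*} [Fintype N]

theorem frobenius_norm_sq {M : Type*} [Fintype M] (A : Matrix M N ℝ) :
    ‖A‖ ^ 2 = ∑ i, ∑ j, A i j ^ 2 := by
  rw [frobenius_norm_def, ← Real.sqrt_eq_rpow, Real.sq_sqrt]
  · simp
  · positivity

theorem frobenius_norm_sq_eq_trace (A : Matrix N N ℝ) : ‖A‖ ^ 2 = (Aᵀ * A).trace := by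
  rw [frobenius_norm_sq, Finset.sum_comm]
  simp [trace, mul_apply, sq]

theorem trace_transpose_mul_eq_zero_of_skew {B : Matrix N N ℝ} (hB : Bᵀ = -B) : B.trace = 0 := by
  have := congrArg trace hB
  rw [trace_transpose, trace_neg] at this
  linarith

variable [DecidableEq N]

/-- The orthogonal matrices commuting with the given matrix. -/
def orthogonalCommutant (ε : Matrix N N ℝ) : Set (Matrix N N ℝ) := {k | kᵀ * k = 1 ∧ k * ε = ε * k}

theorem norm_sub_sq_of_orthogonal {k s : Matrix N N ℝ} (hk : kᵀ * k = 1) (hs : sᵀ * s = 1) :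
    ‖k - s‖ ^ 2 = 2 * (1 : Matrix N N ℝ).trace - 2 * (kᵀ * s).trace := by
  rw [frobenius_norm_sq_eq_trace, transpose_sub, sub_mul, mul_sub, mul_sub, hk, hs]
  have : (sᵀ * k).trace = (kᵀ * s).trace := by
    rw [← trace_transpose, transpose_mul, transpose_transpose]
  simp only [trace_sub, this]
  ring

theorem isCompact_orthogonalCommutant (ε : Matrix N N ℝ) : IsCompact (orthogonalCommutant ε) := by
  refine Metric.isCompact_of_isClosed_isBounded ?_ ?_
  · refine IsClosed.inter (isClosed_eq (by fun_prop) (by fun_prop))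
      (isClosed_eq (by fun_prop) (by fun_prop))
  · rw [isBounded_iff_forall_norm_le]
    refine ⟨√(1 : Matrix N N ℝ).trace, fun k hk => Real.le_sqrt_of_sq_le ?_⟩
    rw [frobenius_norm_sq_eq_trace, hk.1]

/-- Supplies curves through a nearest point that stay in the commutant, for the first-order
condition. -/
theorem exp_smul_mem_orthogonalCommutant {ε B : Matrix N N ℝ} (hB : Bᵀ = -B)
    (hε : B * ε = ε * B) (t : ℝ) : NormedSpace.exp (t • B) ∈ orthogonalCommutant ε := by
  constructor
  · rw [← exp_transpose, transpose_smul, hB, smul_neg, ← exp_add_of_commute]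
    · rw [neg_add_cancel, NormedSpace.exp_zero]
    · exact (Commute.refl _).neg_left
  · have h : Commute (t • B) ε := (show Commute B ε from hε).smul_left t
    exact h.exp_left

theorem mul_mem_orthogonalCommutant {ε k s : Matrix N N ℝ} (hk : k ∈ orthogonalCommutant ε)
    (hs : s ∈ orthogonalCommutant ε) : k * s ∈ orthogonalCommutant ε := by
  constructor
  · rw [transpose_mul, Matrix.mul_assoc, ← Matrix.mul_assoc kᵀ, hk.1, Matrix.one_mul, hs.1]
  · rw [Matrix.mul_assoc, hs.2, ← Matrix.mul_assoc, hk.2, Matrix.mul_assoc]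

theorem transpose_commute_of_mem {ε s : Matrix N N ℝ} (hs : s ∈ orthogonalCommutant ε) :
    sᵀ * ε = ε * sᵀ := by
  have h : s * sᵀ = 1 := mul_eq_one_comm.1 hs.1
  calc sᵀ * ε = sᵀ * ε * (s * sᵀ) := by rw [h, Matrix.mul_one]
    _ = sᵀ * (ε * s) * sᵀ := by simp only [Matrix.mul_assoc]
    _ = sᵀ * (s * ε) * sᵀ := by rw [hs.2]
    _ = (sᵀ * s) * ε * sᵀ := by simp only [Matrix.mul_assoc]
    _ = ε * sᵀ := by rw [hs.1, Matrix.one_mul]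

/-- First-order optimality of a nearest point in the stabilizer. -/
theorem trace_eq_zero_of_nearest {ε J k s B : Matrix N N ℝ} (hk : kᵀ * k = 1)
    (hs : s ∈ orthogonalCommutant ε ∩ orthogonalCommutant J)
    (hmin : ∀ s' ∈ orthogonalCommutant ε ∩ orthogonalCommutant J, ‖k - s‖ ≤ ‖k - s'‖)
    (hB : Bᵀ = -B) (hBε : B * ε = ε * B) (hBJ : B * J = J * B) :
    ((k - s)ᵀ * (s * B)).trace = 0 := by
  let L : Matrix N N ℝ →L[ℝ] ℝ := LinearMap.toContinuousLinearMap
    ((traceLinearMap N ℝ ℝ) ∘ₗ (LinearMap.mulLeft ℝ (kᵀ * s)))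
  have hL : ∀ A, L A = (kᵀ * s * A).trace := fun A => rfl
  have hderiv : HasDerivAt (fun t : ℝ => L (NormedSpace.exp (t • B)))
      (L (NormedSpace.exp ((0 : ℝ) • B) * B)) 0 :=
    L.hasFDerivAt.comp_hasDerivAt 0 (hasDerivAt_exp_smul_const B (0 : ℝ))
  -- Between orthogonal matrices `‖k - s'‖²` is a constant minus `2 tr(kᵀ s')`, so a nearest point
  -- maximises a linear functional.
  have hmax : IsLocalMax (fun t : ℝ => L (NormedSpace.exp (t • B))) 0 := by
    refine Eventually.of_forall fun t => ?_
    have hmem : s * NormedSpace.exp (t • B) ∈ orthogonalCommutant ε ∩ orthogonalCommutant J :=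
      ⟨mul_mem_orthogonalCommutant hs.1 (exp_smul_mem_orthogonalCommutant hB hBε t),
        mul_mem_orthogonalCommutant hs.2 (exp_smul_mem_orthogonalCommutant hB hBJ t)⟩
    have h := pow_le_pow_left₀ (norm_nonneg _) (hmin _ hmem) 2
    rw [norm_sub_sq_of_orthogonal hk hs.1.1, norm_sub_sq_of_orthogonal hk hmem.1.1] at h
    simp only [hL, zero_smul, NormedSpace.exp_zero, Matrix.mul_one, Matrix.mul_assoc]
    linarith
  have h0 := hmax.hasDerivAt_eq_zero hderiv
  rw [hL, zero_smul, NormedSpace.exp_zero, Matrix.one_mul, Matrix.mul_assoc] at h0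
  rw [transpose_sub, sub_mul, trace_sub, h0, ← Matrix.mul_assoc, hs.1.1, Matrix.one_mul,
    trace_transpose_mul_eq_zero_of_skew hB, sub_zero]

/-- Difference of the orthogonality relations of `k` and `s`, divided by `r`. As `r → 0` the right
side vanishes, and limiting directions are tangent to the orthogonal group. -/
theorem skew_of_orthogonal {k s d : Matrix N N ℝ} {r : ℝ} (hk : kᵀ * k = 1) (hs : sᵀ * s = 1)
    (e : k = s + r • d) (hr : r ≠ 0) : sᵀ * d + dᵀ * s = -(r • (dᵀ * d)) := by
  rw [e, transpose_add, transpose_smul, add_mul, mul_add, mul_add, hs, Matrix.smul_mul,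
    Matrix.smul_mul, Matrix.mul_smul, Matrix.mul_smul] at hk
  have h3 : r • (sᵀ * d + dᵀ * s + r • (dᵀ * d)) = 0 := by
    rw [smul_add, smul_add, ← sub_eq_zero.2 hk]
    abel
  exact eq_neg_of_add_eq_zero_left ((smul_eq_zero.1 h3).resolve_left hr)

/-- An orthogonal matrix `k` commuting with `ε` that almost commutes with `J` is close to an
orthogonal matrix commuting with both, with a linear estimate. -/
theorem exists_near_commuting (ε J : Matrix N N ℝ) :
    ∃ C : ℝ, ∀ k ∈ orthogonalCommutant ε,
      ∃ s ∈ orthogonalCommutant ε ∩ orthogonalCommutant J, ‖k - s‖ ≤ C * ‖k * J - J * k‖ := by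
  by_contra hcon
  push Not at hcon
  -- Compactness argument: `k j` violates the bound with constant `j` against the whole stabiliser.
  -- The normalised displacements from nearest points `s j` will converge to a direction that is
  -- both tangent and normal.
  choose k hk hks using fun j : ℕ => hcon j
  obtain ⟨S, hS⟩ : ∃ S, S = orthogonalCommutant ε ∩ orthogonalCommutant J := ⟨_, rfl⟩
  have hScomp : IsCompact S := hS ▸
    (isCompact_orthogonalCommutant ε).inter (isCompact_orthogonalCommutant J)
  have hSne : S.Nonempty := ⟨1, by rw [hS]; simp [orthogonalCommutant]⟩
  rw [← hS] at hks
  have hnear : ∀ j, ∃ s ∈ S, ∀ s' ∈ S, ‖k j - s‖ ≤ ‖k j - s'‖ := by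
    intro j
    obtain ⟨s, hs, hmin⟩ := hScomp.exists_isMinOn hSne
      (f := fun s => ‖k j - s‖) (by fun_prop)
    exact ⟨s, hs, fun s' hs' => hmin hs'⟩
  choose s hsS hsmin using hnear
  obtain ⟨r, hr⟩ : ∃ r : ℕ → ℝ, ∀ j, r j = ‖k j - s j‖ := ⟨_, fun _ => rfl⟩
  have hlt : ∀ j : ℕ, j * ‖k j * J - J * k j‖ < r j := fun j => hr j ▸ hks j _ (hsS j)
  have hrpos : ∀ j, 0 < r j := fun j => lt_of_le_of_lt (by positivity) (hlt j)
  obtain ⟨δ, hδ⟩ : ∃ δ : ℕ → Matrix N N ℝ, ∀ j, δ j = (r j)⁻¹ • (k j - s j) := ⟨_, fun _ => rfl⟩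
  have hδn : ∀ j, ‖δ j‖ = 1 := by
    intro j
    rw [hδ, norm_smul, norm_inv, Real.norm_of_nonneg (hrpos j).le, ← hr,
      inv_mul_cancel₀ (hrpos j).ne']
  have hkδ : ∀ j, k j - s j = r j • δ j := by
    intro j
    rw [hδ, smul_smul, mul_inv_cancel₀ (hrpos j).ne', one_smul]
  have : FirstCountableTopology (Matrix N N ℝ) :=
    inferInstanceAs (FirstCountableTopology (N → N → ℝ))
  obtain ⟨⟨k₀, s₀, d⟩, ⟨hk₀, hs₀, hd⟩, φ, hφ, hlim⟩ :=
    ((isCompact_orthogonalCommutant ε).prod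
      (hScomp.prod (isCompact_sphere (0 : Matrix N N ℝ) 1))).tendsto_subseq
      (x := fun j => (k j, s j, δ j))
      (fun j => ⟨hk j, hsS j, by simpa using hδn j⟩)
  have hk_lim : Tendsto (fun j => k (φ j)) atTop (𝓝 k₀) := (continuous_fst.tendsto _).comp hlim
  have hs_lim : Tendsto (fun j => s (φ j)) atTop (𝓝 s₀) :=
    ((continuous_fst.comp continuous_snd).tendsto _).comp hlim
  have hd_lim : Tendsto (fun j => δ (φ j)) atTop (𝓝 d) :=
    ((continuous_snd.comp continuous_snd).tendsto _).comp hlim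
  have hinv : Tendsto (fun j => ((φ j : ℕ) : ℝ)⁻¹) atTop (𝓝 0) :=
    tendsto_inv_atTop_zero.comp (tendsto_natCast_atTop_atTop.comp hφ.tendsto_atTop)
  have hr_lim : Tendsto (fun j => r (φ j)) atTop (𝓝 ‖k₀ - s₀‖) := by
    simp only [hr]
    exact (hk_lim.sub hs_lim).norm
  have hcommle : ∀ j, 1 ≤ φ j →
      ‖k (φ j) * J - J * k (φ j)‖ ≤ r (φ j) * ((φ j : ℕ) : ℝ)⁻¹ := by
    intro j hj
    have h := (hlt (φ j)).le
    have hpos : (0 : ℝ) < (φ j : ℕ) := by exact_mod_cast hj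
    rw [← div_eq_mul_inv, le_div_iff₀ hpos]
    linarith
  have hev : ∀ᶠ j in atTop, 1 ≤ φ j := hφ.tendsto_atTop.eventually_ge_atTop 1
  have hk₀J : k₀ * J = J * k₀ := by
    have h1 : Tendsto (fun j => ‖k (φ j) * J - J * k (φ j)‖) atTop (𝓝 ‖k₀ * J - J * k₀‖) := by
      have hc : Continuous fun A : Matrix N N ℝ => ‖A * J - J * A‖ := by fun_prop
      exact (hc.tendsto k₀).comp hk_lim
    have h2 := hr_lim.mul hinv
    rw [mul_zero] at h2
    have h3 := le_of_tendsto_of_tendsto h1 h2 (hev.mono hcommle)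
    exact sub_eq_zero.1 (norm_le_zero_iff.1 h3)
  -- The limit belongs to the stabiliser and competes with the nearest points, which forces `r (φ j)
  -- → 0`.
  have hk₀S : k₀ ∈ S := by rw [hS]; exact ⟨hk₀, hk₀.1, hk₀J⟩
  have hr0 : Tendsto (fun j => r (φ j)) atTop (𝓝 0) := by
    have h1 : Tendsto (fun j => ‖k (φ j) - k₀‖) atTop (𝓝 0) := by
      simpa using (hk_lim.sub_const k₀).norm
    refine squeeze_zero (fun j => (hrpos _).le) (fun j => ?_) h1
    rw [hr]
    exact hsmin _ _ hk₀S
  have hδJ : ∀ j, δ j * J - J * δ j = (r j)⁻¹ • (k j * J - J * k j) := by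
    intro j
    have h := (hS ▸ hsS j : s j ∈ orthogonalCommutant ε ∩ orthogonalCommutant J).2.2
    rw [hδ, Matrix.smul_mul, Matrix.mul_smul, ← smul_sub, sub_mul, mul_sub, h]
    congr 1
    abel
  have hδε : ∀ j, δ j * ε = ε * δ j := by
    intro j
    have h := (hS ▸ hsS j : s j ∈ orthogonalCommutant ε ∩ orthogonalCommutant J).1.2
    rw [hδ, Matrix.smul_mul, Matrix.mul_smul, sub_mul, mul_sub, h, (hk j).2]
  have hdJ : d * J = J * d := by
    have h1 : Tendsto (fun j => ‖δ (φ j) * J - J * δ (φ j)‖) atTop (𝓝 ‖d * J - J * d‖) := by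
      have hc : Continuous fun A : Matrix N N ℝ => ‖A * J - J * A‖ := by fun_prop
      exact (hc.tendsto d).comp hd_lim
    refine sub_eq_zero.1 (norm_le_zero_iff.1 (le_of_tendsto_of_tendsto h1 hinv ?_))
    filter_upwards [hev] with j hj
    rw [hδJ, norm_smul, norm_inv, Real.norm_of_nonneg (hrpos _).le, inv_mul_le_iff₀ (hrpos _)]
    exact hcommle j hj
  have hdε : d * ε = ε * d := by
    have hc1 : Continuous fun A : Matrix N N ℝ => A * ε := by fun_prop
    have hc2 : Continuous fun A : Matrix N N ℝ => ε * A := by fun_prop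
    refine tendsto_nhds_unique ((hc1.tendsto d).comp hd_lim) ?_
    refine ((hc2.tendsto d).comp hd_lim).congr fun j => ?_
    exact (hδε (φ j)).symm
  have hskew : s₀ᵀ * d + dᵀ * s₀ = 0 := by
    have hst : Tendsto (fun j => (s (φ j))ᵀ) atTop (𝓝 s₀ᵀ) :=
      (continuous_id.matrix_transpose.tendsto s₀).comp hs_lim
    have hdt : Tendsto (fun j => (δ (φ j))ᵀ) atTop (𝓝 dᵀ) :=
      (continuous_id.matrix_transpose.tendsto d).comp hd_lim
    have h1 : Tendsto (fun j => (s (φ j))ᵀ * δ (φ j) + (δ (φ j))ᵀ * s (φ j)) atTop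
        (𝓝 (s₀ᵀ * d + dᵀ * s₀)) := (hst.mul hd_lim).add (hdt.mul hs_lim)
    have h2 : Tendsto (fun j => -(r (φ j) • ((δ (φ j))ᵀ * δ (φ j)))) atTop (𝓝 0) := by
      simpa using (hr0.smul (hdt.mul hd_lim)).neg
    refine tendsto_nhds_unique h1 (h2.congr fun j => ?_)
    have e : k (φ j) = s (φ j) + r (φ j) • δ (φ j) := by rw [← hkδ]; abel
    have hss := (hS ▸ hsS (φ j) : s (φ j) ∈ orthogonalCommutant ε ∩ orthogonalCommutant J).1.1
    exact (skew_of_orthogonal (hk (φ j)).1 hss e (hrpos _).ne').symm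
  have hs₀' : s₀ ∈ orthogonalCommutant ε ∩ orthogonalCommutant J := hS ▸ hs₀
  -- The matrix `s₀ᵀ d` is skew and commutes with `ε` and `J`, so it is an admissible variation at
  -- every `s j`. In the limit, orthogonality to `δ j` becomes `‖d‖² = 0`, against `‖d‖ = 1`.
  have hzero : ∀ j, ((δ j)ᵀ * (s j * (s₀ᵀ * d))).trace = 0 := by
    intro j
    have h := trace_eq_zero_of_nearest (B := s₀ᵀ * d) (hk j).1 (hS ▸ hsS j)
      (hS ▸ hsmin j)
      (by
        rw [transpose_mul, transpose_transpose]
        exact eq_neg_of_add_eq_zero_right hskew)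
      (by rw [Matrix.mul_assoc, hdε, ← Matrix.mul_assoc, transpose_commute_of_mem hs₀'.1,
        Matrix.mul_assoc])
      (by rw [Matrix.mul_assoc, hdJ, ← Matrix.mul_assoc, transpose_commute_of_mem hs₀'.2,
        Matrix.mul_assoc])
    rw [hkδ, transpose_smul, Matrix.smul_mul, trace_smul, smul_eq_mul] at h
    exact (mul_eq_zero.1 h).resolve_left (hrpos j).ne'
  have hfinal : (dᵀ * (s₀ * (s₀ᵀ * d))).trace = 0 := by
    have hdt : Tendsto (fun j => (δ (φ j))ᵀ) atTop (𝓝 dᵀ) :=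
      (continuous_id.matrix_transpose.tendsto d).comp hd_lim
    have h1 := (continuous_id.matrix_trace.tendsto _).comp (hdt.mul (hs_lim.mul_const (s₀ᵀ * d)))
    refine tendsto_nhds_unique h1 ?_
    exact tendsto_const_nhds.congr fun j => (hzero (φ j)).symm
  have hss : s₀ * s₀ᵀ = 1 := mul_eq_one_comm.1 hs₀'.1.1
  rw [← Matrix.mul_assoc s₀, hss, Matrix.one_mul, ← frobenius_norm_sq_eq_trace] at hfinal
  rw [mem_sphere_zero_iff_norm] at hd
  rw [hd] at hfinal
  norm_num at hfinal

end OrthogonalStabilizer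

/-! ### Doubly stochastic sums, orthogonal invariance, characteristic polynomials. -/

section MatrixTools

open Matrix
open scoped Matrix.Norms.Frobenius

theorem exists_perm_of_multiset_map_eq {ι α : Type*} [Fintype ι] {f g : ι → α}
    (h : Finset.univ.val.map f = Finset.univ.val.map g) : ∃ π : Equiv.Perm ι, ∀ i, f i = g (π i) := by
  classical
  have hcard : ∀ (f : ι → α) (a : α),
      Fintype.card {i // f i = a} = (Finset.univ.val.map f).count a := by
    intro f a
    rw [Fintype.card_subtype, Multiset.count_map, Finset.card_def, Finset.filter_val]
    simp only [eq_comm]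
  have e : ∀ a, Nonempty ({i // f i = a} ≃ {i // g i = a}) := fun a =>
    Fintype.card_eq.1 (by rw [hcard, hcard, h])
  exact ⟨Equiv.ofFiberEquiv fun a => (e a).some, fun i => (Equiv.ofFiberEquiv_map _ i).symm⟩

/-- A weighted rearrangement inequality. -/
theorem sum_doublyStochastic_mul_le {n : ℕ} {A : Matrix (Fin n) (Fin n) ℝ}
    (hA : A ∈ doublyStochastic ℝ (Fin n)) {x y : Fin n → ℝ} (hx : Antitone x) (hy : Antitone y) :
    ∑ i, ∑ j, A i j * (x i * y j) ≤ ∑ i, x i * y i := by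
  -- Birkhoff's theorem reduces the claim to permutation matrices, where it is the rearrangement
  -- inequality.
  obtain ⟨w, hw0, hw1, rfl⟩ := exists_eq_sum_perm_of_mem_doublyStochastic hA
  have h1 : ∑ i, ∑ j, (∑ σ, w σ • Equiv.Perm.permMatrix ℝ σ) i j * (x i * y j)
      = ∑ σ, w σ * ∑ i, x i * y (σ i) := by
    simp only [Matrix.sum_apply, Matrix.smul_apply, smul_eq_mul, Finset.sum_mul, Finset.mul_sum]
    rw [Finset.sum_congr rfl fun i _ => Finset.sum_comm, Finset.sum_comm]
    refine Finset.sum_congr rfl fun σ _ => Finset.sum_congr rfl fun i _ => ?_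
    rw [Finset.sum_eq_single (σ i)]
    · simp [Equiv.Perm.permMatrix, PEquiv.toMatrix_apply]
    · intro j _ hj
      simp [Equiv.Perm.permMatrix, PEquiv.toMatrix_apply, Ne.symm hj]
    · simp
  rw [h1]
  calc ∑ σ, w σ * ∑ i, x i * y (σ i) ≤ ∑ σ, w σ * ∑ i, x i * y i :=
        Finset.sum_le_sum fun σ _ => mul_le_mul_of_nonneg_left
          (hx.monovary hy).sum_mul_comp_perm_le_sum_mul (hw0 σ)
    _ = ∑ i, x i * y i := by rw [← Finset.sum_mul, hw1, one_mul]

theorem sq_mem_doublyStochastic {N : Type*} [Fintype N] [DecidableEq N] {W : Matrix N N ℝ}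
    (hW : Wᵀ * W = 1) : (Matrix.of fun i j => W i j ^ 2) ∈ doublyStochastic ℝ N := by
  rw [mem_doublyStochastic_iff_sum]
  have hW' : W * Wᵀ = 1 := mul_eq_one_comm.1 hW
  refine ⟨fun i j => sq_nonneg _, fun i => ?_, fun j => ?_⟩
  · have := congrFun (congrFun hW' i) i
    simpa [mul_apply, sq] using this
  · have := congrFun (congrFun hW j) j
    simpa [mul_apply, sq] using this

theorem transpose_mul_orthogonal {N : Type*} [Fintype N] [DecidableEq N] {B C : Matrix N N ℝ}
    (hB : Bᵀ * B = 1) (hC : Cᵀ * C = 1) : (Bᵀ * C)ᵀ * (Bᵀ * C) = 1 := by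
  rw [transpose_mul, transpose_transpose, Matrix.mul_assoc, ← Matrix.mul_assoc B,
    mul_eq_one_comm.1 hB, Matrix.one_mul, hC]

theorem mul_orthogonal {N : Type*} [Fintype N] [DecidableEq N] {B C : Matrix N N ℝ}
    (hB : Bᵀ * B = 1) (hC : Cᵀ * C = 1) : (B * C)ᵀ * (B * C) = 1 := by
  rw [transpose_mul, Matrix.mul_assoc, ← Matrix.mul_assoc Bᵀ, hB, Matrix.one_mul, hC]

theorem frobenius_norm_orthogonal_mul {N M : Type*} [Fintype N] [Fintype M] [DecidableEq N]
    {U : Matrix N N ℝ} (hU : Uᵀ * U = 1) (A : Matrix N M ℝ) : ‖U * A‖ = ‖A‖ := by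
  have h : ∀ A : Matrix N M ℝ, ‖A‖ ^ 2 = (Aᵀ * A).trace := by
    intro A
    rw [frobenius_norm_sq, Finset.sum_comm]
    simp [trace, mul_apply, sq]
  refine (sq_eq_sq₀ (norm_nonneg _) (norm_nonneg _)).1 ?_
  rw [h, h, transpose_mul, Matrix.mul_assoc, ← Matrix.mul_assoc Uᵀ, hU, Matrix.one_mul]

theorem frobenius_norm_mul_orthogonal {N M : Type*} [Fintype N] [Fintype M] [DecidableEq M]
    {U : Matrix M M ℝ} (hU : Uᵀ * U = 1) (A : Matrix N M ℝ) : ‖A * U‖ = ‖A‖ := by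
  rw [← frobenius_norm_transpose, transpose_mul, frobenius_norm_orthogonal_mul,
    frobenius_norm_transpose]
  rw [transpose_transpose]
  exact mul_eq_one_comm.1 hU

/-- The signed permutations of the coordinates are isometries. -/
theorem exists_isometryEquiv_signedPerm {n : ℕ} (s : Fin n → ℝ) (hs : ∀ i, s i = 1 ∨ s i = -1)
    (π : Equiv.Perm (Fin n)) :
    ∃ w : EuclideanSpace ℝ (Fin n) ≃ₗᵢ[ℝ] EuclideanSpace ℝ (Fin n),
      ∀ x, w x = WithLp.toLp 2 fun i => s i * x (π i) := by
  let L : EuclideanSpace ℝ (Fin n) →ₗᵢ[ℝ] EuclideanSpace ℝ (Fin n) :=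
    { toFun := fun x => WithLp.toLp 2 fun i => s i * x (π i)
      map_add' := fun x y => by ext i; simp [mul_add]
      map_smul' := fun c x => by ext i; simp; ring
      norm_map' := fun x => by
        refine (sq_eq_sq₀ (norm_nonneg _) (norm_nonneg _)).1 ?_
        rw [EuclideanSpace.real_norm_sq_eq, EuclideanSpace.real_norm_sq_eq,
          ← Equiv.sum_comp π fun i => x i ^ 2]
        refine Finset.sum_congr rfl fun i _ => ?_
        change (s i * x (π i)) ^ 2 = _
        rcases hs i with h | h <;> rw [h] <;> ring }
  exact ⟨L.toLinearIsometryEquiv rfl, fun x => rfl⟩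

theorem charpoly_toEuclideanLin {n : ℕ} (A : Matrix (Fin n) (Fin n) ℝ) :
    (Matrix.toEuclideanLin A).charpoly = A.charpoly := by
  rw [← LinearMap.charpoly_toMatrix _ (EuclideanSpace.basisFun (Fin n) ℝ).toBasis,
    Matrix.toEuclideanLin_eq_toLin_orthonormal, LinearMap.toMatrix_toLin]

theorem charpoly_orthogonal_conj {N : Type*} [Fintype N] [DecidableEq N] {B : Matrix N N ℝ}
    (hB : Bᵀ * B = 1) (D : Matrix N N ℝ) : (B * D * Bᵀ).charpoly = D.charpoly := by
  rw [charpoly_mul_comm, ← Matrix.mul_assoc, hB, Matrix.one_mul]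

theorem exists_perm_eigenvalues {n : ℕ} {T : EuclideanSpace ℝ (Fin n) →ₗ[ℝ] EuclideanSpace ℝ (Fin n)}
    (hT : T.IsSymmetric) (hn : Module.finrank ℝ (EuclideanSpace ℝ (Fin n)) = n) (x : Fin n → ℝ)
    (h : T.charpoly = (diagonal x).charpoly) :
    ∃ π : Equiv.Perm (Fin n), ∀ i, hT.eigenvalues hn i = x (π i) := by
  refine exists_perm_of_multiset_map_eq ?_
  have h1 := hT.roots_charpoly_eq_eigenvalues hn
  have h2 : (diagonal x).charpoly.roots = Finset.univ.val.map x := by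
    rw [charpoly_diagonal, Polynomial.roots_prod _ _ (by
      simp [Finset.prod_ne_zero_iff, Polynomial.X_sub_C_ne_zero])]
    simp
  rw [h, h2] at h1
  exact h1.symm

/-- The entries of an element of `ℝ^{n × m}` as a matrix. -/
def RectMat.toMat {n m : ℕ} (X : RectMat n m) : Matrix (Fin n) (Fin m) ℝ :=
  Matrix.of fun i j => X (i, j)

/-- The element of `ℝ^{n × m}` with the given entries. -/
def RectMat.ofMat {n m : ℕ} (A : Matrix (Fin n) (Fin m) ℝ) : RectMat n m :=
  WithLp.toLp 2 fun p => A p.1 p.2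

namespace RectMat

variable {n m : ℕ}

theorem toMat_injective {X Y : RectMat n m} (h : X.toMat = Y.toMat) : X = Y := by
  ext p
  exact congrFun (congrFun h p.1) p.2

@[simp] theorem toMat_sub (X Y : RectMat n m) : (X - Y).toMat = X.toMat - Y.toMat := rfl

theorem norm_toMat (X : RectMat n m) : ‖X.toMat‖ = ‖X‖ := by
  refine (sq_eq_sq₀ (norm_nonneg _) (norm_nonneg _)).1 ?_
  rw [frobenius_norm_sq, EuclideanSpace.real_norm_sq_eq, Fintype.sum_prod_type]
  rfl

theorem inner_eq_trace (X Y : RectMat n m) : ⟪X, Y⟫_ℝ = (X.toMatᵀ * Y.toMat).trace := by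
  rw [PiLp.inner_apply, Fintype.sum_prod_type, Finset.sum_comm]
  simp [trace, mul_apply, toMat, mul_comm]

theorem toLin_eq (X : RectMat n m) : X.toLin = Matrix.toEuclideanLin X.toMat := rfl

end RectMat

end MatrixTools

/-! ### Eigenvalues of symmetric matrices. -/

section Symmetric

open Matrix
open scoped Matrix.Norms.Frobenius

variable {n : ℕ}

theorem conj_diagonal_symm (B : Matrix (Fin n) (Fin n) ℝ) (x : Fin n → ℝ) :
    (B * diagonal x * Bᵀ)ᵀ = B * diagonal x * Bᵀ := by
  rw [transpose_mul, transpose_mul, transpose_transpose, diagonal_transpose, Matrix.mul_assoc]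

theorem norm_diagonal_euclidean (x : EuclideanSpace ℝ (Fin n)) :
    ‖diagonal fun i => x i‖ = ‖x‖ :=
  frobenius_norm_diagonal (fun i => x i)

namespace SymMat

/-- The matrix of an element of `𝕊^n`. -/
def toMat (X : SymMat n) : Matrix (Fin n) (Fin n) ℝ := RectMat.toMat (X : RectMat n n)

theorem toMat_injective {X Y : SymMat n} (h : X.toMat = Y.toMat) : X = Y :=
  Subtype.ext (RectMat.toMat_injective h)

theorem toMat_sub (X Y : SymMat n) : (X - Y).toMat = X.toMat - Y.toMat := rfl

theorem norm_toMat (X : SymMat n) : ‖X.toMat‖ = ‖X‖ := RectMat.norm_toMat (X : RectMat n n)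

/-- The diagonal embedding `x ↦ B (Diag x) Bᵀ` for an orthogonal matrix `B`. -/
noncomputable def frame (B : Matrix (Fin n) (Fin n) ℝ) (hB : Bᵀ * B = 1) :
    EuclideanSpace ℝ (Fin n) →ₗᵢ[ℝ] SymMat n where
  toFun x := ⟨RectMat.ofMat (B * diagonal (fun i => x i) * Bᵀ), fun i j =>
    (congrFun (congrFun (conj_diagonal_symm B fun i => x i) i) j).symm⟩
  map_add' x y := by
    refine toMat_injective ?_
    change B * diagonal (fun i => x i + y i) * Bᵀ
      = B * diagonal (fun i => x i) * Bᵀ + B * diagonal (fun i => y i) * Bᵀ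
    rw [← Matrix.add_mul, ← Matrix.mul_add, diagonal_add]
  map_smul' c x := by
    refine toMat_injective ?_
    change B * diagonal (fun i => c * x i) * Bᵀ = c • (B * diagonal (fun i => x i) * Bᵀ)
    rw [← Matrix.smul_mul, ← Matrix.mul_smul, ← diagonal_smul]
    rfl
  norm_map' x := by
    rw [← norm_toMat]
    change ‖B * diagonal (fun i => x i) * Bᵀ‖ = _
    rw [frobenius_norm_mul_orthogonal, frobenius_norm_orthogonal_mul hB, norm_diagonal_euclidean]
    rw [transpose_transpose]
    exact mul_eq_one_comm.1 hB

theorem toMat_frame (B : Matrix (Fin n) (Fin n) ℝ) (hB : Bᵀ * B = 1)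
    (x : EuclideanSpace ℝ (Fin n)) :
    (frame B hB x).toMat = B * diagonal (fun i => x i) * Bᵀ := rfl

theorem exists_toMat_eq (X : SymMat n) :
    ∃ B : Matrix (Fin n) (Fin n) ℝ, Bᵀ * B = 1 ∧
      X.toMat = B * diagonal (fun i => X.lam i) * Bᵀ := by
  let b := X.isSymmetric_toLin.eigenvectorBasis finrank_euclideanSpace_fin
  obtain ⟨B, hBdef⟩ : ∃ B : Matrix (Fin n) (Fin n) ℝ, B = Matrix.of fun i k => b k i := ⟨_, rfl⟩
  have hB : Bᵀ * B = 1 := by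
    ext k l
    have h := orthonormal_iff_ite.1 b.orthonormal k l
    rw [PiLp.inner_apply] at h
    rw [mul_apply, one_apply]
    simp only [hBdef, transpose_apply, of_apply]
    rw [← h]
    exact Finset.sum_congr rfl fun i _ => mul_comm _ _
  refine ⟨B, hB, ?_⟩
  have hmul : X.toMat * B = B * diagonal fun i => X.lam i := by
    ext i k
    have h := congrArg (fun v : EuclideanSpace ℝ (Fin n) => v i)
      (X.isSymmetric_toLin.apply_eigenvectorBasis finrank_euclideanSpace_fin k)
    rw [mul_diagonal, hBdef]
    have h2 : (X : RectMat n n).toLin (b k) i = (X.toMat * Matrix.of fun i k => b k i) i k := rfl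
    rw [← h2]
    refine h.trans ?_
    simp [b, lam, mul_comm]
  rw [← hmul, Matrix.mul_assoc, mul_eq_one_comm.1 hB, Matrix.mul_one]

theorem lam_antitone (X : SymMat n) : Antitone fun i => X.lam i :=
  X.isSymmetric_toLin.eigenvalues_antitone finrank_euclideanSpace_fin

theorem exists_perm_lam_frame (B : Matrix (Fin n) (Fin n) ℝ) (hB : Bᵀ * B = 1)
    (x : EuclideanSpace ℝ (Fin n)) :
    ∃ π : Equiv.Perm (Fin n), ∀ i, (frame B hB x).lam i = x (π i) := by
  refine exists_perm_eigenvalues (frame B hB x).isSymmetric_toLin finrank_euclideanSpace_fin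
    (fun i => x i) ?_
  rw [RectMat.toLin_eq, charpoly_toEuclideanLin]
  exact charpoly_orthogonal_conj hB _

/-- The squared entries of the orthogonal matrix `Bᵀ C` are doubly stochastic, which leads to the
trace inequality. -/
theorem inner_frame_frame (B C : Matrix (Fin n) (Fin n) ℝ) (hB : Bᵀ * B = 1) (hC : Cᵀ * C = 1)
    (x y : EuclideanSpace ℝ (Fin n)) :
    ⟪frame B hB x, frame C hC y⟫_ℝ = ∑ i, ∑ j, (Bᵀ * C) i j ^ 2 * (x i * y j) := by
  have h : ⟪frame B hB x, frame C hC y⟫_ℝ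
      = ((frame B hB x).toMatᵀ * (frame C hC y).toMat).trace := RectMat.inner_eq_trace _ _
  rw [h, toMat_frame, toMat_frame, conj_diagonal_symm]
  have e : B * diagonal (fun i => x i) * Bᵀ * (C * diagonal (fun i => y i) * Cᵀ)
      = B * (diagonal (fun i => x i) * ((Bᵀ * C) * diagonal (fun i => y i) * Cᵀ)) := by
    simp only [Matrix.mul_assoc]
  rw [e, trace_mul_comm, Matrix.mul_assoc, Matrix.mul_assoc (Bᵀ * C * _),
    show Cᵀ * B = (Bᵀ * C)ᵀ by rw [transpose_mul, transpose_transpose]]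
  generalize Bᵀ * C = W
  simp only [trace, diag_apply, diagonal_mul]
  refine Finset.sum_congr rfl fun i _ => ?_
  rw [mul_apply, Finset.mul_sum]
  refine Finset.sum_congr rfl fun j _ => ?_
  rw [mul_diagonal, transpose_apply]
  ring

/-- The ordered eigenvalue map is a spectral map for symmetric functions. -/
theorem isSpectralMap_lam {g : EuclideanSpace ℝ (Fin n) → EReal} (hg : IsSymmetricFun g) :
    IsSpectralMap g (SymMat.lam (n := n))
      {φ | ∃ (B : Matrix (Fin n) (Fin n) ℝ) (hB : Bᵀ * B = 1), φ = frame B hB} where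
  exists_frame X := by
    obtain ⟨B, hB, h⟩ := X.exists_toMat_eq
    exact ⟨frame B hB, ⟨B, hB, rfl⟩, toMat_injective h.symm⟩
  inner_le := by
    rintro φ ⟨B, hB, rfl⟩ X Y
    obtain ⟨C, hC, h⟩ := Y.exists_toMat_eq
    have hY : frame C hC Y.lam = Y := toMat_injective h.symm
    conv_lhs => rw [← hY]
    rw [inner_frame_frame]
    refine (sum_doublyStochastic_mul_le (sq_mem_doublyStochastic (transpose_mul_orthogonal hB hC))
      X.lam_antitone Y.lam_antitone).trans (le_of_eq ?_)
    rw [PiLp.inner_apply]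
    exact Finset.sum_congr rfl fun i _ => mul_comm _ _
  invariant := by
    rintro φ ⟨B, hB, rfl⟩ x
    obtain ⟨π, hπ⟩ := exists_perm_lam_frame B hB x
    obtain ⟨w, hw⟩ := exists_isometryEquiv_signedPerm (fun _ => 1) (fun _ => Or.inl rfl) π
    refine ⟨w, ?_, fun y => ?_⟩
    · ext i
      rw [hw, hπ]
      simp
    · rw [hw]
      simpa using hg π y
  exists_near_frame X := by
    obtain ⟨A, hA, hX⟩ := X.exists_toMat_eq
    -- Commuting with `0` imposes nothing, so all orthogonal matrices are admitted.
    obtain ⟨C, hC⟩ := exists_near_commuting (0 : Matrix (Fin n) (Fin n) ℝ) X.toMat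
    refine ⟨2 * C, ?_⟩
    rintro φ ⟨B, hB, rfl⟩
    have hA' : A * Aᵀ = 1 := mul_eq_one_comm.1 hA
    have hAT : Aᵀᵀ * Aᵀ = 1 := by rwa [transpose_transpose]
    -- The rotation from the exact frame `A` of `X` to `B`. Its commutator with `X` has the norm of
    -- the frame defect, and a nearby `s` commuting with `X` gives the exact frame `s A`.
    obtain ⟨k, hk⟩ : ∃ k, k = B * Aᵀ := ⟨_, rfl⟩
    have hkA : k * A = B := by rw [hk, Matrix.mul_assoc, hA, Matrix.mul_one]
    have hko : kᵀ * k = 1 := hk ▸ mul_orthogonal hB hAT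
    obtain ⟨s, ⟨-, hs⟩, hks⟩ := hC k ⟨hko, by simp⟩
    have hso := hs.1
    have hsT : s * sᵀ = 1 := mul_eq_one_comm.1 hso
    have hconj : ∀ x : EuclideanSpace ℝ (Fin n),
        (frame (s * A) (mul_orthogonal hso hA) x).toMat = s * (frame A hA x).toMat * sᵀ := by
      intro x
      rw [toMat_frame, toMat_frame, transpose_mul]
      simp only [Matrix.mul_assoc]
    have hconjk : ∀ x : EuclideanSpace ℝ (Fin n),
        (frame B hB x).toMat = k * (frame A hA x).toMat * kᵀ := by
      intro x
      rw [toMat_frame, toMat_frame, ← hkA, transpose_mul]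
      simp only [Matrix.mul_assoc]
    have hXf : (frame A hA X.lam).toMat = X.toMat := hX.symm
    refine ⟨frame (s * A) (mul_orthogonal hso hA), ⟨_, _, rfl⟩, ?_, fun u => ?_⟩
    · refine toMat_injective ?_
      rw [hconj, hXf, hs.2, Matrix.mul_assoc, hsT, Matrix.mul_one]
    · have hcomm : ‖k * X.toMat - X.toMat * k‖ = ‖frame B hB X.lam - X‖ := by
        rw [← norm_toMat, toMat_sub, hconjk, hXf, ← frobenius_norm_mul_orthogonal hko (_ * kᵀ - _),
          Matrix.sub_mul, Matrix.mul_assoc (k * X.toMat), hko, Matrix.mul_one]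
      rw [hcomm] at hks
      rw [← norm_toMat, toMat_sub, hconj, hconjk]
      have hU : ‖(frame A hA u).toMat‖ = ‖u‖ := by rw [norm_toMat, (frame A hA).norm_map]
      generalize (frame A hA u).toMat = U at hU
      have e : s * U * sᵀ - k * U * kᵀ = (s - k) * U * sᵀ + k * (U * (s - k)ᵀ) := by
        rw [transpose_sub, Matrix.sub_mul, Matrix.sub_mul, Matrix.mul_sub, Matrix.mul_sub,
          ← Matrix.mul_assoc, ← Matrix.mul_assoc]
        abel
      have hsTo : sᵀᵀ * sᵀ = 1 := by rwa [transpose_transpose]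
      rw [e]
      refine (norm_add_le _ _).trans ?_
      rw [frobenius_norm_mul_orthogonal hsTo, frobenius_norm_orthogonal_mul hko]
      have h1 := frobenius_norm_mul (s - k) U
      have h2 := frobenius_norm_mul U (s - k)ᵀ
      rw [frobenius_norm_transpose] at h2
      rw [norm_sub_rev, hU] at h1 h2
      have h3 := mul_le_mul_of_nonneg_right hks (norm_nonneg u)
      linarith

end SymMat

end Symmetric

/-! ### Singular value decomposition and the trace inequality. -/

section Rectangular

open Matrix
open scoped Matrix.Norms.Frobenius

variable {n m : ℕ}

/-- The rectangular diagonal matrix with the given diagonal. -/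
def rectDiag (h : n ≤ m) (x : Fin n → ℝ) : Matrix (Fin n) (Fin m) ℝ :=
  Matrix.of fun i j => if Fin.castLE h i = j then x i else 0

theorem rectDiag_mul_apply (h : n ≤ m) (x : Fin n → ℝ) {K : Type*} (A : Matrix (Fin m) K ℝ)
    (i : Fin n) (k : K) : (rectDiag h x * A) i k = x i * A (Fin.castLE h i) k := by
  simp [rectDiag, mul_apply]

theorem trace_transpose_rectDiag_mul (h : n ≤ m) (x : Fin n → ℝ) (A : Matrix (Fin n) (Fin m) ℝ) :
    ((rectDiag h x)ᵀ * A).trace = ∑ i, x i * A i (Fin.castLE h i) := by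
  rw [trace]
  simp only [diag_apply, mul_apply, transpose_apply]
  rw [Finset.sum_comm]
  simp [rectDiag]

theorem transpose_rectDiag_mul_self (h : n ≤ m) (x : Fin n → ℝ) :
    (rectDiag h x)ᵀ * rectDiag h x
      = diagonal fun j : Fin m => (if hj : j.1 < n then x ⟨j, hj⟩ else 0) ^ 2 := by
  ext j l
  rw [mul_apply, diagonal_apply]
  simp only [transpose_apply, rectDiag, of_apply]
  by_cases hj : j.1 < n
  · rw [Finset.sum_eq_single ⟨j, hj⟩]
    · have : Fin.castLE h ⟨j, hj⟩ = j := rfl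
      rw [this]
      by_cases hjl : j = l
      · subst hjl
        simp [hj, sq]
      · simp [hjl]
    · intro i _ hi
      rw [if_neg, zero_mul]
      rintro rfl
      exact hi rfl
    · simp
  · rw [Finset.sum_eq_zero]
    · simp [hj]
    · intro i _
      rw [if_neg, zero_mul]
      rintro rfl
      exact hj i.2

theorem norm_rectDiag (h : n ≤ m) (x : EuclideanSpace ℝ (Fin n)) :
    ‖rectDiag h fun i => x i‖ = ‖x‖ := by
  refine (sq_eq_sq₀ (norm_nonneg _) (norm_nonneg _)).1 ?_
  rw [frobenius_norm_sq, EuclideanSpace.real_norm_sq_eq]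
  refine Finset.sum_congr rfl fun i _ => ?_
  simp [rectDiag, ite_pow]

theorem sum_castLE_eq (h : n ≤ m) {f : Fin m → ℝ} (hf : ∀ j : Fin m, n ≤ j.1 → f j = 0) :
    ∑ i, f (Fin.castLE h i) = ∑ j, f j := by
  refine Fintype.sum_of_injective (Fin.castLE h) (Fin.castLE_injective h) _ _ (fun j hj => ?_)
    fun _ => rfl
  refine hf j (not_lt.1 fun hlt => hj ⟨⟨j, hlt⟩, rfl⟩)

/-- Both multisets of `m` values end in the same `m - n` zeros, which cancel. -/
theorem exists_perm_castLE (h : n ≤ m) {f g : Fin m → ℝ} (hf : ∀ j : Fin m, n ≤ j.1 → f j = 0)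
    (hg : ∀ j : Fin m, n ≤ j.1 → g j = 0) (hfg : ∃ π : Equiv.Perm (Fin m), ∀ j, f j = g (π j)) :
    ∃ π : Equiv.Perm (Fin n), ∀ i, f (Fin.castLE h i) = g (Fin.castLE h (π i)) := by
  refine exists_perm_of_multiset_map_eq (f := fun i => f (Fin.castLE h i))
    (g := fun i => g (Fin.castLE h i)) ?_
  obtain ⟨p, rfl⟩ := Nat.exists_eq_add_of_le h
  obtain ⟨π, hπ⟩ := hfg
  have h1 : Finset.univ.val.map f = Finset.univ.val.map g := by
    have : f = g ∘ π := funext hπ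
    rw [this, ← Multiset.map_map, Multiset.map_univ_val_equiv]
  simp only [Fin.univ_val_map] at h1 ⊢
  rw [List.ofFn_add, List.ofFn_add, ← Multiset.coe_add, ← Multiset.coe_add] at h1
  have h2 : (fun i : Fin p => f (Fin.natAdd n i)) = fun i => g (Fin.natAdd n i) := by
    funext i
    rw [hf _ (by simp), hg _ (by simp)]
  rw [h2] at h1
  exact add_right_cancel h1

namespace RectMat

/-- The embedding `x ↦ U (Diag x) Vᵀ` for orthogonal matrices `U`, `V`. -/
noncomputable def frame (h : n ≤ m) (U : Matrix (Fin n) (Fin n) ℝ) (V : Matrix (Fin m) (Fin m) ℝ)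
    (hU : Uᵀ * U = 1) (hV : Vᵀ * V = 1) : EuclideanSpace ℝ (Fin n) →ₗᵢ[ℝ] RectMat n m where
  toFun x := ofMat (U * rectDiag h (fun i => x i) * Vᵀ)
  map_add' x y := by
    refine toMat_injective ?_
    change U * rectDiag h (fun i => x i + y i) * Vᵀ
      = U * rectDiag h (fun i => x i) * Vᵀ + U * rectDiag h (fun i => y i) * Vᵀ
    rw [← Matrix.add_mul, ← Matrix.mul_add]
    congr 2
    ext i j
    simp only [rectDiag, of_apply, Matrix.add_apply]
    split_ifs <;> simp
  map_smul' c x := by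
    refine toMat_injective ?_
    change U * rectDiag h (fun i => c * x i) * Vᵀ = c • (U * rectDiag h (fun i => x i) * Vᵀ)
    rw [← Matrix.smul_mul, ← Matrix.mul_smul]
    congr 2
    ext i j
    simp [rectDiag]
  norm_map' x := by
    rw [← norm_toMat]
    change ‖U * rectDiag h (fun i => x i) * Vᵀ‖ = _
    rw [frobenius_norm_mul_orthogonal, frobenius_norm_orthogonal_mul hU, norm_rectDiag]
    rw [transpose_transpose]
    exact mul_eq_one_comm.1 hV

theorem toMat_frame (h : n ≤ m) (U : Matrix (Fin n) (Fin n) ℝ) (V : Matrix (Fin m) (Fin m) ℝ)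
    (hU : Uᵀ * U = 1) (hV : Vᵀ * V = 1) (x : EuclideanSpace ℝ (Fin n)) :
    (frame h U V hU hV x).toMat = U * rectDiag h (fun i => x i) * Vᵀ := rfl

theorem singularValues_eq_zero (X : RectMat n m) {j : ℕ} (hj : n ≤ j) :
    X.toLin.singularValues j = 0 := by
  rw [LinearMap.singularValues_eq_zero_iff_le_finrank_range]
  refine (Submodule.finrank_le _).trans ?_
  rwa [finrank_euclideanSpace_fin]

theorem transpose_mul_self_of_orthonormalBasis {k : ℕ}
    (b : OrthonormalBasis (Fin k) ℝ (EuclideanSpace ℝ (Fin k))) :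
    (Matrix.of fun i j => b j i)ᵀ * (Matrix.of fun i j => b j i) = 1 := by
  ext i j
  have h := orthonormal_iff_ite.1 b.orthonormal i j
  rw [PiLp.inner_apply] at h
  rw [mul_apply, one_apply, ← h]
  exact Finset.sum_congr rfl fun i _ => mul_comm _ _

/-- The singular value decomposition. -/
theorem exists_toMat_eq (h : n ≤ m) (X : RectMat n m) :
    ∃ (U : Matrix (Fin n) (Fin n) ℝ) (V : Matrix (Fin m) (Fin m) ℝ), Uᵀ * U = 1 ∧ Vᵀ * V = 1 ∧
      X.toMat = U * rectDiag h (fun i => X.sigma i) * Vᵀ := by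
  obtain ⟨T, hT⟩ : ∃ T, T = X.toLin := ⟨_, rfl⟩
  obtain ⟨v, hv⟩ : ∃ v, v = T.isSymmetric_adjoint_comp_self.eigenvectorBasis
    finrank_euclideanSpace_fin := ⟨_, rfl⟩
  have hinner : ∀ i j, ⟪T (v i), T (v j)⟫_ℝ = if i = j then T.singularValues i ^ 2 else 0 := by
    intro i j
    have h1 : (LinearMap.adjoint T ∘ₗ T) (v i) = (T.singularValues i ^ 2) • v i := by
      rw [T.sq_singularValues_fin finrank_euclideanSpace_fin, hv,
        LinearMap.IsSymmetric.apply_eigenvectorBasis]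
      rfl
    rw [← LinearMap.adjoint_inner_left, ← LinearMap.comp_apply, h1, real_inner_smul_left,
      orthonormal_iff_ite.1 v.orthonormal i j]
    split_ifs <;> simp
  have hzero : ∀ i : Fin m, T.singularValues i = 0 → T (v i) = 0 := by
    intro i hi
    have := hinner i i
    rw [if_pos rfl, hi, real_inner_self_eq_norm_sq] at this
    exact norm_eq_zero.1 (by nlinarith [norm_nonneg (T (v i))])
  -- Left singular vectors: normalised images of the right ones where the singular value is nonzero,
  -- completed to a basis.
  obtain ⟨b, hb⟩ : ∃ b : OrthonormalBasis (Fin n) ℝ (EuclideanSpace ℝ (Fin n)),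
      ∀ i ∈ {i : Fin n | T.singularValues i ≠ 0},
        b i = (T.singularValues i)⁻¹ • T (v (Fin.castLE h i)) := by
    refine Orthonormal.exists_orthonormalBasis_extension_of_card_eq (by simp)
      (v := fun i : Fin n => (T.singularValues i)⁻¹ • T (v (Fin.castLE h i))) ?_
    rw [orthonormal_iff_ite]
    rintro ⟨i, hi⟩ ⟨j, hj⟩
    change ⟪(T.singularValues i)⁻¹ • T (v (Fin.castLE h i)),
      (T.singularValues j)⁻¹ • T (v (Fin.castLE h j))⟫_ℝ = _
    rw [real_inner_smul_left, real_inner_smul_right, hinner]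
    simp only [Subtype.mk.injEq, Fin.castLE_inj, Fin.val_castLE]
    split_ifs with hij
    · subst hij
      have hi' : T.singularValues i ≠ 0 := hi
      field_simp
    · simp
  have hTv : ∀ i : Fin n, T (v (Fin.castLE h i)) = T.singularValues i • b i := by
    intro i
    by_cases hi : T.singularValues i = 0
    · rw [hzero _ (by simpa using hi), hi, zero_smul]
    · rw [hb i hi, smul_smul, mul_inv_cancel₀ hi, one_smul]
  obtain ⟨V, hVdef⟩ : ∃ V : Matrix (Fin m) (Fin m) ℝ, V = Matrix.of fun i k => v k i := ⟨_, rfl⟩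
  obtain ⟨U, hUdef⟩ : ∃ U : Matrix (Fin n) (Fin n) ℝ, U = Matrix.of fun i k => b k i := ⟨_, rfl⟩
  have hV : Vᵀ * V = 1 := hVdef ▸ transpose_mul_self_of_orthonormalBasis v
  have hU : Uᵀ * U = 1 := hUdef ▸ transpose_mul_self_of_orthonormalBasis b
  refine ⟨U, V, hU, hV, ?_⟩
  have hmul : X.toMat * V = U * rectDiag h fun i => X.sigma i := by
    ext i j
    have h2 : T (v j) i = (X.toMat * V) i j := by rw [hT, hVdef]; rfl
    rw [← h2, mul_apply]
    simp only [rectDiag, of_apply, mul_ite, mul_zero]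
    by_cases hj : j.1 < n
    · rw [Finset.sum_eq_single ⟨j, hj⟩]
      · have e : Fin.castLE h ⟨j, hj⟩ = j := rfl
        have e' : T (v j) = T.singularValues j • b ⟨j, hj⟩ := hTv ⟨j, hj⟩
        rw [if_pos e, e', hUdef]
        simp [sigma, hT, mul_comm]
      · intro k _ hk
        rw [if_neg]
        rintro rfl
        exact hk rfl
      · simp
    · rw [hzero j (hT ▸ X.singularValues_eq_zero (not_lt.1 hj)), Finset.sum_eq_zero]
      · rfl
      · intro k _
        rw [if_neg]
        rintro rfl
        exact hj k.2
  rw [← hmul, Matrix.mul_assoc, mul_eq_one_comm.1 hV, Matrix.mul_one]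

theorem adjoint_comp_self_toLin (X : RectMat n m) :
    LinearMap.adjoint X.toLin ∘ₗ X.toLin = Matrix.toEuclideanLin (X.toMatᵀ * X.toMat) := by
  rw [toLin_eq, ← Matrix.conjTranspose_eq_transpose_of_trivial,
    ← Matrix.toEuclideanLin_conjTranspose_eq_adjoint]
  ext
  simp

/-- Needed because `θ*` is evaluated at `-S` while subregularity is assumed at `σ(S)`. -/
theorem sigma_neg (X : RectMat n m) (h : n ≤ m) : (-X).sigma = X.sigma := by
  have hc : (LinearMap.adjoint (-X).toLin ∘ₗ (-X).toLin).charpoly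
      = (LinearMap.adjoint X.toLin ∘ₗ X.toLin).charpoly := by
    rw [adjoint_comp_self_toLin, adjoint_comp_self_toLin]
    have : (-X).toMat = -X.toMat := rfl
    rw [this, transpose_neg, Matrix.neg_mul, Matrix.mul_neg, neg_neg]
  have he := ((-X).toLin.isSymmetric_adjoint_comp_self.eigenvalues_eq_eigenvalues_iff
    finrank_euclideanSpace_fin X.toLin.isSymmetric_adjoint_comp_self
    finrank_euclideanSpace_fin).2 hc
  ext i
  have h1 := (-X).toLin.singularValues_fin finrank_euclideanSpace_fin (Fin.castLE h i)
  have h2 := X.toLin.singularValues_fin finrank_euclideanSpace_fin (Fin.castLE h i)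
  rw [he] at h1
  exact h1.trans h2.symm

/-- The singular values of `U (Diag x) Vᵀ` are a signed permutation of `x`. -/
theorem exists_signedPerm_sigma_frame (h : n ≤ m) (U : Matrix (Fin n) (Fin n) ℝ)
    (V : Matrix (Fin m) (Fin m) ℝ) (hU : Uᵀ * U = 1) (hV : Vᵀ * V = 1)
    (x : EuclideanSpace ℝ (Fin n)) :
    ∃ (s : Fin n → ℝ) (π : Equiv.Perm (Fin n)), (∀ i, s i = 1 ∨ s i = -1) ∧
      (frame h U V hU hV x).sigma = WithLp.toLp 2 fun i => s i * x (π i) := by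
  obtain ⟨X, hX⟩ : ∃ X, X = frame h U V hU hV x := ⟨_, rfl⟩
  rw [← hX]
  -- Padding by zeros, since `XᵀX` has `m` eigenvalues: they are the squares of `xe`.
  obtain ⟨xe, hxe⟩ : ∃ xe : Fin m → ℝ, xe = fun j : Fin m => if hj : j.1 < n then x ⟨j, hj⟩ else 0 :=
    ⟨_, rfl⟩
  obtain ⟨π, hπ⟩ := exists_perm_eigenvalues X.toLin.isSymmetric_adjoint_comp_self
    finrank_euclideanSpace_fin (fun j : Fin m => xe j ^ 2) (by
      rw [adjoint_comp_self_toLin, charpoly_toEuclideanLin, hX, toMat_frame, transpose_mul,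
        transpose_mul, transpose_transpose, Matrix.mul_assoc, Matrix.mul_assoc,
        ← Matrix.mul_assoc Uᵀ, ← Matrix.mul_assoc Uᵀ, hU, Matrix.one_mul, ← Matrix.mul_assoc _ _ Vᵀ,
        ← Matrix.mul_assoc, charpoly_orthogonal_conj hV, transpose_rectDiag_mul_self, hxe])
  obtain ⟨ρ, hρ⟩ := exists_perm_castLE h (f := fun j : Fin m => X.toLin.singularValues j)
    (g := fun j : Fin m => |xe j|) (fun j hj => X.singularValues_eq_zero hj)
    (fun j hj => by simp [hxe, not_lt.2 hj])
    ⟨π, fun j : Fin m => by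
      rw [X.toLin.singularValues_fin finrank_euclideanSpace_fin, hπ, Real.sqrt_sq_eq_abs]⟩
  refine ⟨fun i => if 0 ≤ x (ρ i) then 1 else -1, ρ, fun i => ?_, ?_⟩
  · beta_reduce
    split_ifs <;> simp
  · ext i
    refine (hρ i).trans ?_
    have : xe (Fin.castLE h (ρ i)) = x (ρ i) := by simp [hxe]
    rw [this]
    change _ = (if 0 ≤ x (ρ i) then 1 else -1) * x (ρ i)
    split_ifs with h0
    · rw [abs_of_nonneg h0, one_mul]
    · rw [abs_of_neg (not_le.1 h0), neg_one_mul]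

theorem inner_frame_frame (h : n ≤ m) (U P : Matrix (Fin n) (Fin n) ℝ)
    (V Q : Matrix (Fin m) (Fin m) ℝ) (hU : Uᵀ * U = 1) (hV : Vᵀ * V = 1) (hP : Pᵀ * P = 1)
    (hQ : Qᵀ * Q = 1) (x y : EuclideanSpace ℝ (Fin n)) :
    ⟪frame h U V hU hV x, frame h P Q hP hQ y⟫_ℝ = ∑ i, ∑ j,
      (Uᵀ * P) i j * (Vᵀ * Q) (Fin.castLE h i) (Fin.castLE h j) * (x i * y j) := by
  rw [inner_eq_trace, toMat_frame, toMat_frame, transpose_mul, transpose_mul, transpose_transpose]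
  have e : V * ((rectDiag h fun i => x i)ᵀ * Uᵀ) * (P * (rectDiag h fun i => y i) * Qᵀ)
      = V * ((rectDiag h fun i => x i)ᵀ * ((Uᵀ * P) * ((rectDiag h fun i => y i) * Qᵀ))) := by
    simp only [Matrix.mul_assoc]
  rw [e, trace_mul_comm, Matrix.mul_assoc, Matrix.mul_assoc (Uᵀ * P), Matrix.mul_assoc (rectDiag _ _),
    show Qᵀ * V = (Vᵀ * Q)ᵀ by rw [transpose_mul, transpose_transpose],
    trace_transpose_rectDiag_mul]
  refine Finset.sum_congr rfl fun i _ => ?_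
  rw [mul_apply, Finset.mul_sum]
  refine Finset.sum_congr rfl fun j _ => ?_
  rw [rectDiag_mul_apply, transpose_apply]
  ring

theorem sigma_antitone (X : RectMat n m) : Antitone fun i => X.sigma i :=
  fun _ _ hij => X.toLin.singularValues_antitone hij

/-- The trace inequality for singular values. -/
theorem sum_mul_sigma_le (h : n ≤ m) {W : Matrix (Fin n) (Fin n) ℝ} {Z : Matrix (Fin m) (Fin m) ℝ}
    (hW : Wᵀ * W = 1) (hZ : Zᵀ * Z = 1) (X Y : RectMat n m) :
    ∑ i, ∑ j, W i j * Z (Fin.castLE h i) (Fin.castLE h j) * (X.sigma i * Y.sigma j)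
      ≤ ∑ i, X.sigma i * Y.sigma i := by
  have h1 := sum_doublyStochastic_mul_le (sq_mem_doublyStochastic hW) X.sigma_antitone
    Y.sigma_antitone
  have h2 := sum_doublyStochastic_mul_le (sq_mem_doublyStochastic hZ)
    (x := fun j : Fin m => X.toLin.singularValues j) (y := fun j => Y.toLin.singularValues j)
    (fun _ _ hij => X.toLin.singularValues_antitone hij)
    (fun _ _ hij => Y.toLin.singularValues_antitone hij)
  rw [← sum_castLE_eq h, ← sum_castLE_eq h] at h2
  · rw [Finset.sum_congr rfl fun i _ => (sum_castLE_eq h fun j hj => by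
      simp [Y.singularValues_eq_zero hj]).symm] at h2
    -- From `2 W Z ≤ W² + Z²` with nonnegative weights; `Z` is treated in size `m`, where the padded
    -- singular values vanish.
    have h3 : ∀ i j, W i j * Z (Fin.castLE h i) (Fin.castLE h j) * (X.sigma i * Y.sigma j)
        ≤ 1 / 2 * (W i j ^ 2 * (X.sigma i * Y.sigma j))
          + 1 / 2 * (Z (Fin.castLE h i) (Fin.castLE h j) ^ 2 * (X.sigma i * Y.sigma j)) := by
      intro i j
      have hx : 0 ≤ X.sigma i := X.toLin.singularValues_nonneg i
      have hy : 0 ≤ Y.sigma j := Y.toLin.singularValues_nonneg j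
      nlinarith [mul_nonneg (mul_nonneg hx hy)
        (sq_nonneg (W i j - Z (Fin.castLE h i) (Fin.castLE h j)))]
    have h4 := Finset.sum_le_sum fun i (_ : i ∈ Finset.univ) =>
      Finset.sum_le_sum fun j (_ : j ∈ Finset.univ) => h3 i j
    refine h4.trans ?_
    simp only [Finset.sum_add_distrib, ← Finset.mul_sum]
    have h5 : ∑ i, ∑ j, Z (Fin.castLE h i) (Fin.castLE h j) ^ 2 * (X.sigma i * Y.sigma j)
        ≤ ∑ i, X.sigma i * Y.sigma i := h2
    have h6 : ∑ i, ∑ j, W i j ^ 2 * (X.sigma i * Y.sigma j)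
        ≤ ∑ i, X.sigma i * Y.sigma i := h1
    linarith
  · intro j hj
    simp [X.singularValues_eq_zero hj]
  · intro i hi
    refine Finset.sum_eq_zero fun j _ => ?_
    simp [X.singularValues_eq_zero hi]

end RectMat

end Rectangular

/-! ### Stability of singular frames. -/

section RectangularSpectral

open Matrix
open scoped Matrix.Norms.Frobenius

variable {n m : ℕ}

theorem frobenius_norm_sq_fromBlocks {N M : Type*} [Fintype N] [Fintype M]
    (A : Matrix N N ℝ) (B : Matrix N M ℝ) (C : Matrix M N ℝ) (D : Matrix M M ℝ) :
    ‖fromBlocks A B C D‖ ^ 2 = ‖A‖ ^ 2 + ‖B‖ ^ 2 + ‖C‖ ^ 2 + ‖D‖ ^ 2 := by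
  simp only [frobenius_norm_sq, Fintype.sum_sum_type, fromBlocks_apply₁₁, fromBlocks_apply₁₂,
    fromBlocks_apply₂₁, fromBlocks_apply₂₂, Finset.sum_add_distrib]
  ring

/-- A pair of orthogonal matrices that almost intertwines `A` with itself is close to a pair that
does so exactly, with a linear estimate. -/
theorem exists_near_intertwining {N M : Type*} [Fintype N] [Fintype M] [DecidableEq N]
    [DecidableEq M] (A : Matrix N M ℝ) :
    ∃ C : ℝ, ∀ (k : Matrix N N ℝ) (l : Matrix M M ℝ), kᵀ * k = 1 → lᵀ * l = 1 →
      ∃ (s : Matrix N N ℝ) (t : Matrix M M ℝ), sᵀ * s = 1 ∧ tᵀ * t = 1 ∧ s * A = A * t ∧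
        ‖k - s‖ ≤ C * ‖k * A * lᵀ - A‖ ∧ ‖l - t‖ ≤ C * ‖k * A * lᵀ - A‖ := by
  -- Commuting with `diag(1, -1)` means being block diagonal, and commuting with the off-diagonal
  -- block matrix of `A` encodes `s A = A t`.
  obtain ⟨C, hC⟩ := exists_near_commuting (fromBlocks (1 : Matrix N N ℝ) 0 0 (-1 : Matrix M M ℝ))
    (fromBlocks 0 A Aᵀ 0)
  refine ⟨|C| * 2, fun k l hk hl => ?_⟩
  obtain ⟨S, ⟨hSε, hSJ⟩, hS⟩ := hC (fromBlocks k 0 0 l) ⟨by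
    rw [fromBlocks_transpose, fromBlocks_multiply]
    simp [hk, hl], by
    rw [fromBlocks_multiply, fromBlocks_multiply]
    simp⟩
  obtain ⟨s, p, q, t, rfl⟩ : ∃ s p q t, S = fromBlocks s p q t :=
    ⟨_, _, _, _, (fromBlocks_toBlocks S).symm⟩
  have hε := hSε.2
  rw [fromBlocks_multiply, fromBlocks_multiply, fromBlocks_inj] at hε
  simp only [Matrix.mul_one, Matrix.mul_zero, add_zero, Matrix.mul_neg, zero_add, Matrix.one_mul,
    Matrix.zero_mul, Matrix.neg_mul] at hε
  have hp : p = 0 := by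
    have h := hε.2.1
    ext i j
    have := congrFun (congrFun h i) j
    rw [Matrix.neg_apply] at this
    rw [Matrix.zero_apply]
    linarith
  have hq : q = 0 := by
    have h := hε.2.2.1
    ext i j
    have := congrFun (congrFun h i) j
    rw [Matrix.neg_apply] at this
    rw [Matrix.zero_apply]
    linarith
  subst hp hq
  have ho := hSε.1
  rw [fromBlocks_transpose, fromBlocks_multiply, ← fromBlocks_one, fromBlocks_inj] at ho
  simp only [transpose_zero, Matrix.mul_zero, add_zero, Matrix.zero_mul, zero_add] at ho
  have hJ := hSJ.2
  rw [fromBlocks_multiply, fromBlocks_multiply, fromBlocks_inj] at hJ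
  simp only [Matrix.mul_zero, add_zero, Matrix.zero_mul, zero_add] at hJ
  have hl' : l * lᵀ = 1 := mul_eq_one_comm.1 hl
  have hkT : kᵀᵀ * kᵀ = 1 := by rw [transpose_transpose]; exact mul_eq_one_comm.1 hk
  have h1 : ‖k * A - A * l‖ = ‖k * A * lᵀ - A‖ := by
    rw [← frobenius_norm_mul_orthogonal hl (k * A * lᵀ - A), Matrix.sub_mul,
      Matrix.mul_assoc (k * A), hl, Matrix.mul_one]
  have h2 : ‖l * Aᵀ - Aᵀ * k‖ = ‖k * A * lᵀ - A‖ := by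
    rw [← frobenius_norm_transpose, transpose_sub, transpose_mul, transpose_mul,
      transpose_transpose, ← frobenius_norm_orthogonal_mul hkT (k * A * lᵀ - A), Matrix.mul_sub,
      ← Matrix.mul_assoc, ← Matrix.mul_assoc, hk, Matrix.one_mul]
  -- Two nonzero blocks, each of norm `‖k A lᵀ - A‖`; the factor `2` majorises `√2`.
  have h3 : ‖fromBlocks k 0 0 l * fromBlocks 0 A Aᵀ 0 - fromBlocks 0 A Aᵀ 0 * fromBlocks k 0 0 l‖
      ≤ 2 * ‖k * A * lᵀ - A‖ := by
    refine le_of_sq_le_sq ?_ (by positivity)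
    rw [fromBlocks_multiply, fromBlocks_multiply, sub_eq_add_neg, fromBlocks_neg, fromBlocks_add,
      frobenius_norm_sq_fromBlocks]
    simp only [Matrix.mul_zero, add_zero, Matrix.zero_mul, zero_add, neg_zero, norm_zero,
      ← sub_eq_add_neg]
    rw [h1, h2]
    nlinarith [sq_nonneg ‖k * A * lᵀ - A‖]
  have h4 : ‖fromBlocks k 0 0 l - fromBlocks s 0 0 t‖ ≤ |C| * 2 * ‖k * A * lᵀ - A‖ := by
    refine hS.trans ?_
    rw [mul_assoc]
    exact mul_le_mul (le_abs_self C) h3 (norm_nonneg _) (abs_nonneg C)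
  have h5 : ‖fromBlocks k 0 0 l - fromBlocks s 0 0 t‖ ^ 2 = ‖k - s‖ ^ 2 + ‖l - t‖ ^ 2 := by
    rw [sub_eq_add_neg, fromBlocks_neg, fromBlocks_add, frobenius_norm_sq_fromBlocks]
    simp [← sub_eq_add_neg]
  refine ⟨s, t, ho.1, ho.2.2.2, hJ.2.1, ?_, ?_⟩
  · refine le_trans (le_of_sq_le_sq ?_ (norm_nonneg _)) h4
    rw [h5]
    exact le_add_of_nonneg_right (sq_nonneg _)
  · refine le_trans (le_of_sq_le_sq ?_ (norm_nonneg _)) h4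
    rw [h5]
    exact le_add_of_nonneg_left (sq_nonneg _)

namespace RectMat

/-- The singular value map is a spectral map for absolutely symmetric functions. -/
theorem isSpectralMap_sigma (h : n ≤ m) {g : EuclideanSpace ℝ (Fin n) → EReal}
    (hg : IsAbsSymmetricFun g) :
    IsSpectralMap g (RectMat.sigma (n := n) (m := m))
      {φ | ∃ (U : Matrix (Fin n) (Fin n) ℝ) (V : Matrix (Fin m) (Fin m) ℝ) (hU : Uᵀ * U = 1)
        (hV : Vᵀ * V = 1), φ = frame h U V hU hV} where
  exists_frame X := by
    obtain ⟨U, V, hU, hV, hX⟩ := X.exists_toMat_eq h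
    exact ⟨frame h U V hU hV, ⟨U, V, hU, hV, rfl⟩, toMat_injective hX.symm⟩
  inner_le := by
    rintro φ ⟨U, V, hU, hV, rfl⟩ X Y
    obtain ⟨P, Q, hP, hQ, hY⟩ := Y.exists_toMat_eq h
    have hY' : frame h P Q hP hQ Y.sigma = Y := toMat_injective hY.symm
    conv_lhs => rw [← hY']
    rw [inner_frame_frame]
    refine (sum_mul_sigma_le h (transpose_mul_orthogonal hU hP) (transpose_mul_orthogonal hV hQ)
      X Y).trans (le_of_eq ?_)
    rw [PiLp.inner_apply]
    exact Finset.sum_congr rfl fun i _ => mul_comm _ _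
  invariant := by
    rintro φ ⟨U, V, hU, hV, rfl⟩ x
    obtain ⟨s, π, hs, hsx⟩ := exists_signedPerm_sigma_frame h U V hU hV x
    obtain ⟨w, hw⟩ := exists_isometryEquiv_signedPerm s hs π
    refine ⟨w, ?_, fun y => ?_⟩
    · rw [hsx, hw]
    · rw [hw]
      exact hg π s hs y
  exists_near_frame X := by
    obtain ⟨A, B, hA, hB, hX⟩ := X.exists_toMat_eq h
    obtain ⟨C, hC⟩ := exists_near_intertwining X.toMat
    refine ⟨2 * C, ?_⟩
    rintro φ ⟨U, V, hU, hV, rfl⟩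
    have hAT : Aᵀᵀ * Aᵀ = 1 := by rw [transpose_transpose]; exact mul_eq_one_comm.1 hA
    have hBT : Bᵀᵀ * Bᵀ = 1 := by rw [transpose_transpose]; exact mul_eq_one_comm.1 hB
    obtain ⟨k, hk⟩ : ∃ k, k = U * Aᵀ := ⟨_, rfl⟩
    obtain ⟨l, hl⟩ : ∃ l, l = V * Bᵀ := ⟨_, rfl⟩
    have hkA : k * A = U := by rw [hk, Matrix.mul_assoc, hA, Matrix.mul_one]
    have hlB : l * B = V := by rw [hl, Matrix.mul_assoc, hB, Matrix.mul_one]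
    have hko : kᵀ * k = 1 := hk ▸ mul_orthogonal hU hAT
    have hlo : lᵀ * l = 1 := hl ▸ mul_orthogonal hV hBT
    obtain ⟨s, t, hs, ht, hst, hks, hlt⟩ := hC k l hko hlo
    have htT : t * tᵀ = 1 := mul_eq_one_comm.1 ht
    have hconj : ∀ x : EuclideanSpace ℝ (Fin n),
        (frame h (s * A) (t * B) (mul_orthogonal hs hA) (mul_orthogonal ht hB) x).toMat
          = s * (frame h A B hA hB x).toMat * tᵀ := by
      intro x
      rw [toMat_frame, toMat_frame, transpose_mul]
      simp only [Matrix.mul_assoc]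
    have hconjk : ∀ x : EuclideanSpace ℝ (Fin n),
        (frame h U V hU hV x).toMat = k * (frame h A B hA hB x).toMat * lᵀ := by
      intro x
      rw [toMat_frame, toMat_frame, ← hkA, ← hlB, transpose_mul]
      simp only [Matrix.mul_assoc]
    have hXf : (frame h A B hA hB X.sigma).toMat = X.toMat := hX.symm
    refine ⟨_, ⟨_, _, mul_orthogonal hs hA, mul_orthogonal ht hB, rfl⟩, ?_, fun u => ?_⟩
    · refine toMat_injective ?_
      rw [hconj, hXf, hst, Matrix.mul_assoc, htT, Matrix.mul_one]
    · have hcomm : ‖k * X.toMat * lᵀ - X.toMat‖ = ‖frame h U V hU hV X.sigma - X‖ := by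
        rw [← norm_toMat, toMat_sub, hconjk, hXf]
      rw [hcomm] at hks hlt
      rw [← norm_toMat, toMat_sub, hconj, hconjk]
      have hD : ‖(frame h A B hA hB u).toMat‖ = ‖u‖ := by
        rw [norm_toMat, (frame h A B hA hB).norm_map]
      generalize (frame h A B hA hB u).toMat = D at hD
      have e : s * D * tᵀ - k * D * lᵀ = (s - k) * D * tᵀ + k * (D * (t - l)ᵀ) := by
        rw [transpose_sub, Matrix.sub_mul, Matrix.sub_mul, Matrix.mul_sub, Matrix.mul_sub,
          ← Matrix.mul_assoc, ← Matrix.mul_assoc]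
        abel
      have htTo : tᵀᵀ * tᵀ = 1 := by rwa [transpose_transpose]
      rw [e]
      refine (norm_add_le _ _).trans ?_
      rw [frobenius_norm_mul_orthogonal htTo, frobenius_norm_orthogonal_mul hko]
      have h1 := frobenius_norm_mul (s - k) D
      have h2 := frobenius_norm_mul D (t - l)ᵀ
      rw [frobenius_norm_transpose, norm_sub_rev t] at h2
      rw [norm_sub_rev s] at h1
      rw [hD] at h1 h2
      have h3 := mul_le_mul_of_nonneg_right hks (norm_nonneg u)
      have h4 := mul_le_mul_of_nonneg_right hlt (norm_nonneg u)
      linarith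

end RectMat

end RectangularSpectral

/-! ### Passage from singular values to eigenvalues, and the theorem. -/

section Main

theorem mem_subdiff_isometryEquiv_iff {U : Type*} [NormedAddCommGroup U] [InnerProductSpace ℝ U]
    {p : U → EReal} (w : U ≃ₗᵢ[ℝ] U) (hw : ∀ y, p (w y) = p y) {x v : U} :
    w v ∈ subdiff p (w x) ↔ v ∈ subdiff p x := by
  constructor
  · intro h y
    have := h (w y)
    rwa [hw, hw, ← map_sub, w.inner_map_map] at this
  · intro h y
    have := h (w.symm y)
    rw [← hw (w.symm y), w.apply_symm_apply] at this
    rwa [hw, ← w.apply_symm_apply y, ← map_sub, w.inner_map_map, w.apply_symm_apply]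

/-- Metric subregularity of the subdifferential is invariant under isometries that leave the
function invariant. -/
theorem MetricallySubregularAt.of_isometryEquiv {U : Type*} [NormedAddCommGroup U]
    [InnerProductSpace ℝ U] {p : U → EReal} (w : U ≃ₗᵢ[ℝ] U) (hw : ∀ y, p (w y) = p y) {u v : U}
    (h : MetricallySubregularAt (subdiff p) (w u) (w v)) :
    MetricallySubregularAt (subdiff p) u v := by
  obtain ⟨hv, δ, hδ, ε, hε, κ, hκ, H⟩ := h
  refine ⟨(mem_subdiff_isometryEquiv_iff w hw).1 hv, δ, hδ, ε, hε, κ, hκ, fun x hx => ?_⟩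
  have h1 := H (w x) (by rwa [Metric.mem_closedBall, w.dist_map])
  have e1 : {x' | w v ∈ subdiff p x'} = w '' {x' | v ∈ subdiff p x'} := by
    ext z
    constructor
    · intro hz
      refine ⟨w.symm z, ?_, w.apply_symm_apply z⟩
      refine (mem_subdiff_isometryEquiv_iff w hw).1 ?_
      rw [w.apply_symm_apply]
      exact hz
    · rintro ⟨z, hz, rfl⟩
      exact (mem_subdiff_isometryEquiv_iff w hw).2 hz
  have e2 : subdiff p (w x) ∩ Metric.closedBall (w v) δ
      = w '' (subdiff p x ∩ Metric.closedBall v δ) := by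
    ext z
    constructor
    · rintro ⟨hz1, hz2⟩
      refine ⟨w.symm z, ⟨?_, ?_⟩, w.apply_symm_apply z⟩
      · refine (mem_subdiff_isometryEquiv_iff w hw).1 ?_
        rw [w.apply_symm_apply]
        exact hz1
      · rw [Metric.mem_closedBall, ← w.dist_map, w.apply_symm_apply]
        exact hz2
    · rintro ⟨z, ⟨hz1, hz2⟩, rfl⟩
      exact ⟨(mem_subdiff_isometryEquiv_iff w hw).2 hz1, by rwa [Metric.mem_closedBall, w.dist_map]⟩
  rwa [e1, e2, Metric.infEDist_image w.isometry, Metric.infEDist_image w.isometry] at h1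

theorem IsAbsSymmetricFun.isSymmetricFun {n : ℕ} {g : EuclideanSpace ℝ (Fin n) → EReal}
    (hg : IsAbsSymmetricFun g) : IsSymmetricFun g := fun π x => by
  simpa using hg π (fun _ => 1) (fun _ => Or.inl rfl) x

/-- The singular values of a symmetric matrix are a signed permutation of its eigenvalues. -/
theorem SymMat.exists_signedPerm_sigma {n : ℕ} (X : SymMat n) :
    ∃ (s : Fin n → ℝ) (π : Equiv.Perm (Fin n)), (∀ i, s i = 1 ∨ s i = -1) ∧
      X.sigma = WithLp.toLp 2 fun i => s i * X.lam (π i) := by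
  obtain ⟨B, hB, hX⟩ := X.exists_toMat_eq
  -- A spectral decomposition is a singular frame with `U = V = B`, up to signs and order.
  have h : RectMat.frame le_rfl B B hB hB X.lam = (X : RectMat n n) := by
    refine RectMat.toMat_injective ?_
    refine Eq.trans ?_ hX.symm
    rw [RectMat.toMat_frame]
    congr 2
  have := RectMat.exists_signedPerm_sigma_frame le_rfl B B hB hB X.lam
  rwa [h] at this

end Main

end MatrixOpt

theorem theorem18 :
    (∀ (n m d e : ℕ) (_ : n ≤ m) (g : EuclideanSpace ℝ (Fin n) → EReal)
        (P : MatrixOpt.Problem (MatrixOpt.RectMat n m) d e) (Zbar : MatrixOpt.DualVar (MatrixOpt.RectMat n m) d e),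
      MatrixOpt.IsProperClosedConvex g →
      MatrixOpt.IsAbsSymmetricFun g →
      P.IsAdmissible →
      (∀ X, P.θ X = g (MatrixOpt.RectMat.sigma X)) →
      Zbar ∈ P.dualSolutions →
      (P.dualMultipliers Zbar).Nonempty →
      MatrixOpt.IsC1OnOpenDomain (MatrixOpt.conj P.h) →
      MatrixOpt.IsStronglyConvexOnCompacts (MatrixOpt.conj P.h) →
      (∀ wbar ∈ MatrixOpt.subdiff (MatrixOpt.conj g) (MatrixOpt.RectMat.sigma (MatrixOpt.DualVar.S Zbar)),
        MatrixOpt.MetricallySubregularAt (MatrixOpt.subdiff (MatrixOpt.conj g))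
          (MatrixOpt.RectMat.sigma (MatrixOpt.DualVar.S Zbar)) wbar) →
      (∃ Xbar ∈ P.dualMultipliers Zbar, MatrixOpt.BoundedlyLinearlyRegular
        ![P.VD, P.GD1 Xbar, MatrixOpt.GD2 (MatrixOpt.DualVar.w Zbar), P.GD3 Xbar]) →
      P.DualQuadraticGrowthAt Zbar) ∧
    (∀ (n d e : ℕ) (g : EuclideanSpace ℝ (Fin n) → EReal)
        (P : MatrixOpt.Problem (MatrixOpt.SymMat n) d e) (Zbar : MatrixOpt.DualVar (MatrixOpt.SymMat n) d e),
      MatrixOpt.IsProperClosedConvex g →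
      MatrixOpt.IsAbsSymmetricFun g →
      P.IsAdmissible →
      (∀ X, P.θ X = g (MatrixOpt.SymMat.sigma X)) →
      Zbar ∈ P.dualSolutions →
      (P.dualMultipliers Zbar).Nonempty →
      MatrixOpt.IsC1OnOpenDomain (MatrixOpt.conj P.h) →
      MatrixOpt.IsStronglyConvexOnCompacts (MatrixOpt.conj P.h) →
      (∀ wbar ∈ MatrixOpt.subdiff (MatrixOpt.conj g) (MatrixOpt.SymMat.sigma (MatrixOpt.DualVar.S Zbar)),
        MatrixOpt.MetricallySubregularAt (MatrixOpt.subdiff (MatrixOpt.conj g))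
          (MatrixOpt.SymMat.sigma (MatrixOpt.DualVar.S Zbar)) wbar) →
      (∃ Xbar ∈ P.dualMultipliers Zbar, MatrixOpt.BoundedlyLinearlyRegular
        ![P.VD, P.GD1 Xbar, MatrixOpt.GD2 (MatrixOpt.DualVar.w Zbar), P.GD3 Xbar]) →
      P.DualQuadraticGrowthAt Zbar) ∧
    (∀ (n d e : ℕ) (g : EuclideanSpace ℝ (Fin n) → EReal)
        (P : MatrixOpt.Problem (MatrixOpt.SymMat n) d e) (Zbar : MatrixOpt.DualVar (MatrixOpt.SymMat n) d e),
      MatrixOpt.IsProperClosedConvex g →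
      MatrixOpt.IsSymmetricFun g →
      P.IsAdmissible →
      (∀ X, P.θ X = g (MatrixOpt.SymMat.lam X)) →
      Zbar ∈ P.dualSolutions →
      (P.dualMultipliers Zbar).Nonempty →
      MatrixOpt.IsC1OnOpenDomain (MatrixOpt.conj P.h) →
      MatrixOpt.IsStronglyConvexOnCompacts (MatrixOpt.conj P.h) →
      (∀ wbar ∈ MatrixOpt.subdiff (MatrixOpt.conj g) (MatrixOpt.SymMat.lam (-MatrixOpt.DualVar.S Zbar)),
        MatrixOpt.MetricallySubregularAt (MatrixOpt.subdiff (MatrixOpt.conj g))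
          (MatrixOpt.SymMat.lam (-MatrixOpt.DualVar.S Zbar)) wbar) →
      (∃ Xbar ∈ P.dualMultipliers Zbar, MatrixOpt.BoundedlyLinearlyRegular
        ![P.VD, P.GD1 Xbar, MatrixOpt.GD2 (MatrixOpt.DualVar.w Zbar), P.GD3 Xbar]) →
      P.DualQuadraticGrowthAt Zbar) := by
  refine ⟨?_, ?_, ?_⟩
  · intro n m d e h g P Zbar hg hsym hP hθ hZ _ hC1 hsc hsub hreg
    refine P.dualQuadraticGrowthAt_of_isSpectralMap (MatrixOpt.RectMat.isSpectralMap_sigma h hsym)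
      hg.proper hP hθ hZ hC1 hsc ?_ hreg
    rwa [MatrixOpt.RectMat.sigma_neg _ h]
  · intro n d e g P Zbar hg hsym hP hθ hZ _ hC1 hsc hsub hreg
    -- Absolute symmetry of `g` makes `g ∘ σ` and `g ∘ λ` agree on `𝕊^n`.
    have hθ' : ∀ X, P.θ X = g (MatrixOpt.SymMat.lam X) := by
      intro X
      obtain ⟨s, π, hs, hX⟩ := X.exists_signedPerm_sigma
      rw [hθ, hX]
      exact hsym π s hs _
    refine P.dualQuadraticGrowthAt_of_isSpectralMap
      (MatrixOpt.SymMat.isSpectralMap_lam hsym.isSymmetricFun) hg.proper hP hθ' hZ hC1 hsc ?_ hreg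
    -- The signed permutation carrying `λ(-S̄)` to `σ(S̄)` preserves `g*` and transports
    -- subregularity back to `λ(-S̄)`.
    obtain ⟨s, π, hs, hX⟩ := (-Zbar.S).exists_signedPerm_sigma
    obtain ⟨w, hw⟩ := MatrixOpt.exists_isometryEquiv_signedPerm s hs π
    have hgw : ∀ y, g (w y) = g y := fun y => by rw [hw]; exact hsym π s hs y
    have hcw : ∀ y, MatrixOpt.conj g (w y) = MatrixOpt.conj g y :=
      MatrixOpt.conj_comp_isometryEquiv w hgw
    have hneg : (-Zbar.S).sigma = Zbar.S.sigma := MatrixOpt.RectMat.sigma_neg _ le_rfl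
    have hwS : w (MatrixOpt.SymMat.lam (-Zbar.S)) = Zbar.S.sigma := by
      rw [hw, ← hneg, hX]
    intro v hv
    refine MatrixOpt.MetricallySubregularAt.of_isometryEquiv w hcw ?_
    rw [hwS]
    refine hsub _ ?_
    rw [← hwS]
    exact (MatrixOpt.mem_subdiff_isometryEquiv_iff w hcw).2 hv
  · intro n d e g P Zbar hg hsym hP hθ hZ _ hC1 hsc hsub hreg
    exact P.dualQuadraticGrowthAt_of_isSpectralMap (MatrixOpt.SymMat.isSpectralMap_lam hsym)
      hg.proper hP hθ hZ hC1 hsc hsub hreg
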